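/- **Theorem (consistency of the network GMM estimator).** *Model.* On a probability space $(\Omega,\mathcal F,P)$ and for each $n\ge 1$, let $\mathcal C_n\subseteq\mathcal F$ be a $\sigma$-algebra (common shocks), and let the following be $\mathcal C_n$-measurable: an undirected random network $A_n$ without loops on the nodes $1,\dots,n$, covariates $X_{n,i}$ and exogenous variables $Z_{n,i}$ with values in Euclidean spaces; $\mathbf Z=(Z_{n,i})_i$, $\tilde Z_{n,i}=(1,Z_{n,i}')'$, and $\tilde A_{ij}=A_{ij}/\sum_kA_{ik}$ (a zero row for an isolated node). Let $\nu_{n,i}$ and $e_{n,i}=(e^{(\tau)}_{n,i})_\tau$ ($\tau$ an exposure level) be real random variables such that, conditionally on $\mathcal C_n$, the pairs $(\nu_{n,i},e_{n,i})$, $i\le n$, are independent and each $\nu_{n,i}$ has the standard logistic distribution function $F(v)=1/(1+e^{-v})$. For $b\in\mathbb R^{\dim Z+1}$ and $|\ell|<4$ let $P(b,\ell)=(P_1,\dots,P_n)$ be the (unique) solution of $P_i=F(\tilde Z_{n,i}'b+\ell\sum_j\tilde A_{ij}P_j)$. With true coefficients $\beta_D,\lambda,\beta_X^{(\tau)},\beta_p^{(\tau)}$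 the data are $$D_{n,i}=\mathbb 1\Big\{\tilde Z_{n,i}'\beta_D+\lambda\sum_j\tilde A_{ij}P_j(\beta_D,\lambda)-\nu_{n,i}\ge 0\Big\},\qquad T_{n,i}=T_{n,i}(\mathbf D_n),\qquad Y_{n,i}=Y_{n,i}(\mathbf D_n),$$ where $Y_{n,i}(\mathbf d)=X_{n,i}'\beta_X^{(\tau)}+F(\nu_{n,i})\beta_p^{(\tau)}+e^{(\tau)}_{n,i}$ for $\tau=T_{n,i}(\mathbf d)$. The exposure mapping $T_{n,i}(\mathbf d)\in\mathbb R^{1+q}$ is a function of $A_n$ and $\mathbf d\in\{0,1\}^n$; its first coordinate is $d_i$, and for some $K$ that does not depend on $n$ and $i$ it depends on the other treatments only through those of the nodes $j\ne i$ at path distance at most $K$ from $i$, and is invariant under permutations of these nodes. Put $W_{n,i}=(Y_{n,i},T_{n,i},D_{n,i})$. *Moments and estimator.* Fix two exposure levels $t,t'$. For $\beta=(b,\ell,b_X,b_p,b_X',b_p')$, with $P=P(b,\ell)$ and $M=\operatorname{diag}(1/(P_j(1-P_j)))-\ell\tilde A$, let $\partial_kP=M^{-1}(\tilde Z_{n,jk})_j$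 and $\partial_\ell P=M^{-1}\tilde AP$. The moment function $g((W_{n,i},X_{n,i},\mathbf Z),\beta)$ (which also depends on $i$ and $A_n$) consists of $$(D_i-P_i)\Big(\tilde Z_{ik}+\ell\sum_j\tilde A_{ij}\partial_kP_j\Big)_{k},\qquad (D_i-P_i)\Big(\sum_j\tilde A_{ij}P_j+\ell\sum_j\tilde A_{ij}\partial_\ell P_j\Big),$$ $$\mathbb 1\{T_i=t\}\,2X_i\,r_i,\qquad \mathbb 1\{T_i=t\}\,c_i\,r_i,\qquad r_i=Y_i-X_i'b_X-\tfrac{c_i}{2}b_p,\quad c_i=P_i\text{ if }t_1=1,\ c_i=1+P_i\text{ otherwise},$$ and the last two moments again with $(t',b_X',b_p')$ in place of $(t,b_X,b_p)$. Let $\hat g_n(\beta)=n^{-1}\sum_ig((W_{n,i},X_{n,i},\mathbf Z),\beta)$, $g_n(\beta)=n^{-1}\sum_iE[g((W_{n,i},X_{n,i},\mathbf Z),\beta)\mid\mathcal C_n]$, $\hat Q_n=\hat g_n'\hat\Xi_n\hat g_n$ and $Q_n=g_n'\Xi_ng_n$. Let $\hat\beta_n$ be a measurable minimiser of $\hat Q_n$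 over the parameter space $\Theta$, and let $\beta_0=(\beta_D,\lambda,\beta_X^{(t)},\beta_p^{(t)},\beta_X^{(t')},\beta_p^{(t')})$. *Dependence coefficients.* Let $N(i,s)$ and $N^\partial(i,s)$ be the sets of nodes at path distance at most $s$ and exactly $s$ from $i$, $\delta_n^\partial(s)=n^{-1}\sum_i|N^\partial(i,s)|$. Let $D_{n,i}^{(s)}$ be $D_{n,i}$ with the shocks $\nu_{n,j}$, $j\notin N(i,s)$, replaced by $0$, and let $T_{n,i}^{(s)},Y_{n,i}^{(s)}$ be $T_{n,i},Y_{n,i}$ evaluated with the treatments $D_{n,j}$, $j\notin N(i,s)$, replaced by $0$. Put $\theta^D_{n,s}=2\max_iE[|D_{n,i}-D_{n,i}^{(s)}|\mid\mathcal C_n]$ and $$\theta^W_{n,s}=2\Big(\max_iE[|Y_{n,i}-Y_{n,i}^{(s)}|\mid\mathcal C_n]+\max_iE[\|T_{n,i}-T_{n,i}^{(s)}\|_2\mid\mathcal C_n]\Big)+\max_i|N(i,s)|\,\theta^D_{n,s}.$$ *Assumptions.* 1. For some $\epsilon>0$ and all $n,i$: $E[\|W_{n,i}\|_{1+\epsilon}^{1+\epsilon}\mid\mathcal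 C_n]<\infty$ a.s. 2. $\frac1n\sum_{s\ge1}\delta_n^\partial(s)\,\theta^W_{n,\lfloor(s-1)/4\rfloor}\to0$ a.s. 3. $\Theta\subset\mathbb R^{\dim g}$ is compact and $|\ell|<4$ for all $\beta\in\Theta$. 4. For each $\beta\in\Theta$ the function $w\mapsto g((w,x,\mathbf z),\beta)$ is bounded and Lipschitz on the support of the data, with constants that do not depend on $n$, $i$, the network and $(x,\mathbf z)$. 5. There is $\bar L$ such that $\|g((w,x,\mathbf z),\beta)-g((w,x,\mathbf z),\beta')\|_2\le\bar L\|\beta-\beta'\|_2$ for all $\beta,\beta'\in\Theta$, all $n$, $i$ and all $(w,x,\mathbf z)$ in the support of the data. (In 4 and 5, the support of the data is the support of $(W_{n,i},X_{n,i},\mathbf Z)$ on the event that $A_n$ is the given network.) 6. The random matrices $\hat\Xi_n$ and $\Xi_n$ are a.s. positive definite, $\Xi_n$ is $\mathcal C_n$-measurable, $\sup_nE[\|\hat\Xi_n\|_F\mid\mathcal C_n]<\infty$ a.s., and $E[\|\hat\Xi_n-\Xi_n\|_F\mid\mathcal C_n]\to0$ a.s. 7. (Identification) $\beta_0\in\Theta$;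 $g_n(\beta_0)=0$ a.s. for all $n\ge1$; and for every $\epsilon>0$ there is an a.s. positive random variable $\kappa$ such that for each $\beta\in\Theta$ with $\|\beta-\beta_0\|_2\ge\epsilon$, a.s., $Q_n(\beta)\ge\kappa$ for all large $n$. *Conclusion.* For all $\epsilon>0$, $$P(\|\hat\beta_n-\beta_0\|_2>\epsilon\mid\mathcal C_n)\to0\quad\text{a.s. as }n\to\infty,$$ and $\hat\beta_n\to\beta_0$ in probability. -/

import Mathlib

open MeasureTheory ProbabilityTheory Filter Topology
open scoped ENNReal

noncomputable section

namespace NetworkGMM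

/-! ### Networks -/

/-- Entry `A_ij` of the adjacency matrix of an undirected network without self-loops. -/
def adj {n : ℕ} (G : SimpleGraph (Fin n)) (i j : Fin n) : ℝ :=
  open Classical in if G.Adj i j then 1 else 0

/-- Row-normalised adjacency matrix `A_ij / n_i`, where `n_i = ∑_j A_ij`
(a zero row for a node without neighbours). -/
def rowAdj {n : ℕ} (G : SimpleGraph (Fin n)) : Matrix (Fin n) (Fin n) ℝ :=
  fun i j => (∑ k, adj G i k)⁻¹ * adj G i j

/-- `N_A(i,s)`: the nodes at path distance at most `s` from `i`
(the distance between different components is infinite). -/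
def nbhd {n : ℕ} (G : SimpleGraph (Fin n)) (i : Fin n) (s : ℕ) : Finset (Fin n) :=
  open Classical in Finset.univ.filter fun j => G.edist i j ≤ (s : ℕ∞)

/-- `N_A^∂(i,s)`: the nodes at path distance exactly `s` from `i`. -/
def sphere {n : ℕ} (G : SimpleGraph (Fin n)) (i : Fin n) (s : ℕ) : Finset (Fin n) :=
  open Classical in Finset.univ.filter fun j => G.edist i j = (s : ℕ∞)

/-- `δ_n^∂(s) = n⁻¹ ∑_i |N_A^∂(i,s)|`. -/
def sphereAvg {n : ℕ} (G : SimpleGraph (Fin n)) (s : ℕ) : ℝ≥0∞ :=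
  (n : ℝ≥0∞)⁻¹ * ∑ i, ((sphere G i s).card : ℝ≥0∞)

/-- `max_i |N_A(i,s)|`. -/
def nbhdMax {n : ℕ} (G : SimpleGraph (Fin n)) (s : ℕ) : ℝ≥0∞ :=
  ⨆ i, ((nbhd G i s).card : ℝ≥0∞)

/-- Real value of a binary treatment. -/
def bval (b : Bool) : ℝ := if b then 1 else 0

/-- Replace by zero all entries outside `N_A(i,s)`: treatments. -/
def truncTreat {n : ℕ} (G : SimpleGraph (Fin n)) (i : Fin n) (s : ℕ) (d : Fin n → Bool) :
    Fin n → Bool :=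
  fun j => open Classical in if j ∈ nbhd G i s then d j else false

/-- Replace by zero all entries outside `N_A(i,s)`: shocks. -/
def truncShock {n : ℕ} (G : SimpleGraph (Fin n)) (i : Fin n) (s : ℕ) (v : Fin n → ℝ) :
    Fin n → ℝ :=
  fun j => open Classical in if j ∈ nbhd G i s then v j else 0

/-! ### Treatment choice -/

/-- Exogenous variables with the intercept `Z_{i0} = 1` added. -/
def withIntercept {kz : ℕ} (z : Fin kz → ℝ) : Fin (kz + 1) → ℝ := Fin.cons 1 z

/-- `Z_i' β_D + λ n_i⁻¹ ∑_j A_ij p_j`. -/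
def choiceIndex {n kz : ℕ} (G : SimpleGraph (Fin n)) (z : Fin n → Fin kz → ℝ)
    (bD : Fin (kz + 1) → ℝ) (lam : ℝ) (p : Fin n → ℝ) (i : Fin n) : ℝ :=
  (∑ k, withIntercept (z i) k * bD k) + lam * ∑ j, rowAdj G i j * p j

/-- `p` solves the equilibrium system with standard logistic private shocks
(`Real.sigmoid t = 1 / (1 + exp (-t))`). -/
def IsEquilibrium {n kz : ℕ} (G : SimpleGraph (Fin n)) (z : Fin n → Fin kz → ℝ)
    (bD : Fin (kz + 1) → ℝ) (lam : ℝ) (p : Fin n → ℝ) : Prop :=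
  ∀ i, p i = Real.sigmoid (choiceIndex G z bD lam p i)

/-- The vector of equilibrium choice probabilities `P(Z, A)` at the parameter `(β_D, λ)`: the
solution of the equilibrium system (it is unique if `|λ| < 4`). -/
def eqProb {n kz : ℕ} (G : SimpleGraph (Fin n)) (z : Fin n → Fin kz → ℝ)
    (bD : Fin (kz + 1) → ℝ) (lam : ℝ) : Fin n → ℝ :=
  open Classical in
  if h : ∃ p, IsEquilibrium G z bD lam p then h.choose else 0

/-- The treatment choices `D_i = 1{Z_i'β_D + λ n_i⁻¹ ∑_j A_ij P_j(Z,A) - ν_i ≥ 0}`. -/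
def treat {n kz : ℕ} (G : SimpleGraph (Fin n)) (z : Fin n → Fin kz → ℝ)
    (bD : Fin (kz + 1) → ℝ) (lam : ℝ) (v : Fin n → ℝ) : Fin n → Bool :=
  fun i => open Classical in
    decide (0 ≤ choiceIndex G z bD lam (eqProb G z bD lam) i - v i)

/-- The matrix `diag(1 / (P_i (1 - P_i))) - λ Ã`, with `Ã` the row-normalised adjacency matrix. -/
def scoreMatrix {n kz : ℕ} (G : SimpleGraph (Fin n)) (z : Fin n → Fin kz → ℝ)
    (bD : Fin (kz + 1) → ℝ) (lam : ℝ) : Matrix (Fin n) (Fin n) ℝ :=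
  Matrix.diagonal
    (fun i => 1 / (eqProb G z bD lam i * (1 - eqProb G z bD lam i))) - lam • rowAdj G

/-- `∂P/∂β_{Dk}`. -/
def dProbBD {n kz : ℕ} (G : SimpleGraph (Fin n)) (z : Fin n → Fin kz → ℝ)
    (bD : Fin (kz + 1) → ℝ) (lam : ℝ) (k : Fin (kz + 1)) : Fin n → ℝ :=
  ((scoreMatrix G z bD lam)⁻¹).mulVec fun i => withIntercept (z i) k

/-- `∂P/∂λ`. -/
def dProbLam {n kz : ℕ} (G : SimpleGraph (Fin n)) (z : Fin n → Fin kz → ℝ)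
    (bD : Fin (kz + 1) → ℝ) (lam : ℝ) : Fin n → ℝ :=
  ((scoreMatrix G z bD lam)⁻¹).mulVec ((rowAdj G).mulVec (eqProb G z bD lam))

/-! ### Parameters and moment functions -/

/-- Space of exposure levels `t = (t_1, t_2)`: coordinate `0` is the own treatment. -/
abbrev Expo (q : ℕ) : Type := EuclideanSpace ℝ (Fin (q + 1))

/-- Space of the points `w = (y, t, d)`. -/
abbrev WPoint (q : ℕ) : Type := ℝ × Expo q × ℝ

/-- Euclidean distance of two points `(y, t, d)`. -/
def wDist {q : ℕ} (w w' : WPoint q) : ℝ :=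
  Real.sqrt (|w.1 - w'.1| ^ 2 + ‖w.2.1 - w'.2.1‖ ^ 2 + |w.2.2 - w'.2.2| ^ 2)

/-- Coordinates of `β = (β_D, λ, β_X^{(t)}, β_p^{(t)}, β_X^{(t')}, β_p^{(t')})`. -/
abbrev PIdx (kz kx : ℕ) : Type :=
  (Fin (kz + 1) ⊕ Unit) ⊕ ((Fin kx ⊕ Unit) ⊕ (Fin kx ⊕ Unit))

abbrev Param (kz kx : ℕ) : Type := EuclideanSpace ℝ (PIdx kz kx)

def paramD {kz kx : ℕ} (β : Param kz kx) (k : Fin (kz + 1)) : ℝ := β (Sum.inl (Sum.inl k))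

def paramLam {kz kx : ℕ} (β : Param kz kx) : ℝ := β (Sum.inl (Sum.inr ()))

/-- `(1 + P)` replaces `P` in the second-stage moments if `t_1 = 0`. -/
def control {q : ℕ} (t : Expo q) (p : ℝ) : ℝ :=
  open Classical in if t 0 = 1 then p else 1 + p

/-- The second-stage moments `(g^{β_X^{(t)}}, g^{β_p^{(t)}})` for the exposure level `t` at the
coefficients `b = (β_X^{(t)}, β_p^{(t)})`; `p` is the choice probability of the node. -/
def secondStage {kx q : ℕ} (t : Expo q) (p : ℝ) (w : WPoint q) (x : Fin kx → ℝ)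
    (b : Fin kx ⊕ Unit → ℝ) : Fin kx ⊕ Unit → ℝ :=
  open Classical in
  let resid : ℝ := w.1 - (∑ k, x k * b (Sum.inl k)) - control t p / 2 * b (Sum.inr ())
  Sum.elim (fun k => (if w.2.1 = t then 1 else 0) * (2 * x k) * resid)
    (fun _ => (if w.2.1 = t then 1 else 0) * control t p * resid)

/-- The moment function `g((w, x, z), β)` of node `i` in the network `G`, for a comparison of the
exposure levels `t` and `t'`. -/
def moment {n kz kx q : ℕ} (t t' : Expo q) (G : SimpleGraph (Fin n)) (i : Fin n)
    (w : WPoint q) (x : Fin kx → ℝ) (z : Fin n → Fin kz → ℝ) (β : Param kz kx) : Param kz kx :=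
  let bD := paramD β
  let lam := paramLam β
  let P := eqProb G z bD lam
  WithLp.toLp 2 <|
    Sum.elim
      (Sum.elim
        (fun k => (w.2.2 - P i) *
          (withIntercept (z i) k + lam * ∑ j, rowAdj G i j * dProbBD G z bD lam k j))
        (fun _ => (w.2.2 - P i) *
          ((∑ j, rowAdj G i j * P j) + lam * ∑ j, rowAdj G i j * dProbLam G z bD lam j)))
      (Sum.elim
        (secondStage t (P i) w x fun a => β (Sum.inr (Sum.inl a)))
        (secondStage t' (P i) w x fun a => β (Sum.inr (Sum.inr a))))

/-- `v' M v`. -/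
def quad {ι : Type*} [Fintype ι] (M : Matrix ι ι ℝ) (v : EuclideanSpace ℝ ι) : ℝ :=
  ∑ a, ∑ b, v a * M a b * v b

/-- Frobenius norm `√ trace(M'M)`. -/
def frob {ι : Type*} [Fintype ι] (M : Matrix ι ι ℝ) : ℝ :=
  Real.sqrt (M.transpose * M).trace

/-! ### The triangular array -/

/-- The primitives of the model. Row `n` has the nodes `Fin n`. -/
structure NetworkModel (Ω : Type*) (kz kx q : ℕ) where
  /-- common shocks -/
  C : ℕ → MeasurableSpace Ω
  /-- network -/
  A : (n : ℕ) → Ω → SimpleGraph (Fin n)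
  /-- covariates -/
  X : (n : ℕ) → Fin n → Ω → Fin kx → ℝ
  /-- exogenous variables of the treatment choice -/
  Z : (n : ℕ) → Fin n → Ω → Fin kz → ℝ
  /-- private shocks of the treatment choice -/
  ν : (n : ℕ) → Fin n → Ω → ℝ
  /-- outcome errors `e_i^{(t)}` -/
  e : (n : ℕ) → Fin n → Ω → Expo q → ℝ
  /-- exposure mapping `T(i, d, A)` -/
  expo : (n : ℕ) → SimpleGraph (Fin n) → Fin n → (Fin n → Bool) → Expo q
  /-- true coefficients: `β_D`, `λ`, `β_X^{(t)}`, `β_p^{(t)}` -/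
  bD : Fin (kz + 1) → ℝ
  lam : ℝ
  bX : Expo q → Fin kx → ℝ
  bp : Expo q → ℝ

/-- Independence, conditionally on `m`, of a finite family of random elements. -/
def CondIndepFamily {Ω : Type*} (m : MeasurableSpace Ω) [MeasurableSpace Ω] (μ : Measure Ω)
    {ι E : Type*} [Fintype ι] [MeasurableSpace E] (ξ : ι → Ω → E) : Prop :=
  ∀ B : ι → Set E, (∀ i, MeasurableSet (B i)) →
    μ⟦⋂ i, ξ i ⁻¹' B i | m⟧ =ᵐ[μ] fun ω => ∏ i, (μ⟦ξ i ⁻¹' B i | m⟧) ω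

namespace NetworkModel

variable {Ω : Type*} {kz kx q : ℕ} (M : NetworkModel Ω kz kx q)

/-- The matrix `𝐙` of row `n`. -/
def Zmat (n : ℕ) (ω : Ω) : Fin n → Fin kz → ℝ := fun i => M.Z n i ω

/-- Treatments `𝐃_n`. -/
def D (n : ℕ) (ω : Ω) : Fin n → Bool :=
  treat (M.A n ω) (M.Zmat n ω) M.bD M.lam fun j => M.ν n j ω

/-- `D_{n,i}^{(s)}`: the treatment of `i` with the shocks outside `N(i,s)` set to zero. -/
def DTrunc (n : ℕ) (i : Fin n) (s : ℕ) (ω : Ω) : Bool :=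
  treat (M.A n ω) (M.Zmat n ω) M.bD M.lam
    (truncShock (M.A n ω) i s fun j => M.ν n j ω) i

/-- Exposure of node `i` under the treatment vector `d`. -/
def TPot (n : ℕ) (i : Fin n) (d : Fin n → Bool) (ω : Ω) : Expo q := M.expo n (M.A n ω) i d

/-- Outcome of node `i` under the treatment vector `d`:
`Y_i = X_i'β_X^{(t)} + V_i β_p^{(t)} + e_i^{(t)}` with `t = T_i(d)` and `V_i = F(ν_i)`. -/
def YPot (n : ℕ) (i : Fin n) (d : Fin n → Bool) (ω : Ω) : ℝ :=
  (∑ k, M.X n i ω k * M.bX (M.TPot n i d ω) k)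
    + Real.sigmoid (M.ν n i ω) * M.bp (M.TPot n i d ω) + M.e n i ω (M.TPot n i d ω)

/-- Observed exposure `T_{n,i}`. -/
def T (n : ℕ) (i : Fin n) (ω : Ω) : Expo q := M.TPot n i (M.D n ω) ω

/-- Observed outcome `Y_{n,i}`. -/
def Y (n : ℕ) (i : Fin n) (ω : Ω) : ℝ := M.YPot n i (M.D n ω) ω

/-- `T_{n,i}^{(s)}`: exposure with the treatments outside `N(i,s)` set to zero. -/
def TTrunc (n : ℕ) (i : Fin n) (s : ℕ) (ω : Ω) : Expo q :=
  M.TPot n i (truncTreat (M.A n ω) i s (M.D n ω)) ω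

/-- `Y_{n,i}^{(s)}`: outcome with the treatments outside `N(i,s)` set to zero. -/
def YTrunc (n : ℕ) (i : Fin n) (s : ℕ) (ω : Ω) : ℝ :=
  M.YPot n i (truncTreat (M.A n ω) i s (M.D n ω)) ω

/-- `W_{n,i} = (Y_{n,i}, T_{n,i}, D_{n,i})`. -/
def W (n : ℕ) (i : Fin n) (ω : Ω) : WPoint q := (M.Y n i ω, M.T n i ω, bval (M.D n ω i))

/-- The true parameter `β_0` for the exposure levels `t`, `t'`. -/
def trueParam (t t' : Expo q) : Param kz kx :=
  WithLp.toLp 2 <|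
    Sum.elim (Sum.elim M.bD fun _ => M.lam)
      (Sum.elim (Sum.elim (M.bX t) fun _ => M.bp t) (Sum.elim (M.bX t') fun _ => M.bp t'))

/-- `g((W_{n,i}, X_{n,i}, 𝐙), β)`. -/
def g (t t' : Expo q) (n : ℕ) (i : Fin n) (β : Param kz kx) (ω : Ω) : Param kz kx :=
  moment t t' (M.A n ω) i (M.W n i ω) (M.X n i ω) (M.Zmat n ω) β

/-- Sample moments `ĝ_n(β)`. -/
def gHat (t t' : Expo q) (n : ℕ) (β : Param kz kx) (ω : Ω) : Param kz kx :=
  (n : ℝ)⁻¹ • ∑ i, M.g t t' n i β ω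

/-- Sample objective function `Q̂_n(β) = ĝ_n(β)' Ξ̂_n ĝ_n(β)`. -/
def QHat (t t' : Expo q) (Xihat : ℕ → Ω → Matrix (PIdx kz kx) (PIdx kz kx) ℝ)
    (n : ℕ) (β : Param kz kx) (ω : Ω) : ℝ :=
  quad (Xihat n ω) (M.gHat t t' n β ω)

section Probability

variable [MeasurableSpace Ω] (μ : Measure Ω)

/-- Population moments given the common shocks, `g_n(β) = n⁻¹ ∑_i E[g((W_{n,i},X_{n,i},𝐙),β) | C_n]`
(the nodes need not be identically distributed given `C_n`). -/
def gPop (t t' : Expo q) (n : ℕ) (β : Param kz kx) (ω : Ω) : Param kz kx :=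
  (n : ℝ)⁻¹ • ∑ i, (μ[M.g t t' n i β | M.C n]) ω

/-- Population objective function `Q_n(β) = g_n(β)' Ξ_n g_n(β)`. -/
def QPop (t t' : Expo q) (Xi : ℕ → Ω → Matrix (PIdx kz kx) (PIdx kz kx) ℝ)
    (n : ℕ) (β : Param kz kx) (ω : Ω) : ℝ :=
  quad (Xi n ω) (M.gPop μ t t' n β ω)

/-- `θ_{n,s}^D = 2 max_i E[|D_i - D_i^{(s)}| | C_n]`. Conditional expectations of nonnegative
variables take values in `[0, ∞]`. -/
def thetaD (n s : ℕ) (ω : Ω) : ℝ≥0∞ :=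
  2 * ⨆ i, condLExp (M.C n) μ
    (fun ω' => ENNReal.ofReal |bval (M.D n ω' i) - bval (M.DTrunc n i s ω')|) ω

/-- `θ_{n,s}^W = 2 (max_i E[|Y_i - Y_i^{(s)}| | C_n] + max_i E[‖T_i - T_i^{(s)}‖ | C_n])
+ max_i |N(i,s)| θ_{n,s}^D`. -/
def thetaW (n s : ℕ) (ω : Ω) : ℝ≥0∞ :=
  2 * ((⨆ i, condLExp (M.C n) μ
          (fun ω' => ENNReal.ofReal |M.Y n i ω' - M.YTrunc n i s ω'|) ω)
      + ⨆ i, condLExp (M.C n) μ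
          (fun ω' => ENNReal.ofReal ‖M.T n i ω' - M.TTrunc n i s ω'‖) ω)
    + nbhdMax (M.A n ω) s * M.thetaD μ n s ω

/-- Dependence coefficient for node sets at distance at least `s ≥ 1`. The number `θ_{n,r}^W`
controls conditional covariances across a distance of at least `4r + 1`, so that the coefficient
at distance `s` is `θ_{n,r}^W` with `r` the largest number such that `4r + 1 ≤ s`. -/
def psiCoeff (n s : ℕ) (ω : Ω) : ℝ≥0∞ := M.thetaW μ n ((s - 1) / 4) ω

/-- Support of `(W_{n,i}, X_{n,i}, 𝐙)` on the event that the network of row `n` is `G`. -/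
def dataSupport (n : ℕ) (i : Fin n) (G : SimpleGraph (Fin n)) :
    Set (WPoint q × (Fin kx → ℝ) × (Fin n → Fin kz → ℝ)) :=
  ((μ.restrict {ω | M.A n ω = G}).map
    fun ω => (M.W n i ω, M.X n i ω, M.Zmat n ω)).support

/-- Measurability: the common shocks `C_n` determine the network, the covariates and the
exogenous variables. -/
structure IsMeasurable : Prop where
  le : ∀ n, M.C n ≤ ‹MeasurableSpace Ω›
  network : ∀ n i j, MeasurableSet[M.C n] {ω | (M.A n ω).Adj i j}
  covariates : ∀ n i, Measurable[M.C n] (M.X n i)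
  exogenous : ∀ n i, Measurable[M.C n] (M.Z n i)
  shocks : ∀ n i, Measurable (M.ν n i)
  errors : ∀ n i, Measurable (M.e n i)

/-- Conditionally on the common shocks, the pairs of a private shock and outcome errors are
independent across the nodes, and the private shocks are standard logistic. -/
structure ShockAssumption : Prop where
  indep : ∀ n, CondIndepFamily (M.C n) μ fun i ω => (M.ν n i ω, M.e n i ω)
  logistic : ∀ n i x, μ⟦M.ν n i ⁻¹' Set.Iic x | M.C n⟧ =ᵐ[μ] fun _ => Real.sigmoid x

/-- `T_i(d) = (d_i, f_i(d_j : j ∈ N(i,K), j ≠ i))` for a function `f_i`, given the network, that is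
invariant under permutations of the `K`-neighbours of `i`. -/
structure ExposureAssumption (K : ℕ) : Prop where
  own : ∀ n G i d, M.expo n G i d 0 = bval (d i)
  isLocal : ∀ n G i d d', (∀ j ∈ nbhd G i K, d j = d' j) → M.expo n G i d = M.expo n G i d'
  anonymous : ∀ n G i d (π : Equiv.Perm (Fin n)), π i = i → (∀ j ∉ nbhd G i K, π j = j) →
    M.expo n G i (d ∘ π) = M.expo n G i d

/-- The regularity conditions of the law of large numbers. -/
structure RegularityLLN (t t' : Expo q) (Θ : Set (Param kz kx)) : Prop where
  /-- conditional moments of order `1 + ε` -/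
  moments : ∃ ε : ℝ, 0 < ε ∧ ∀ n i, ∀ᵐ ω ∂μ, condLExp (M.C n) μ
    (fun ω' => ENNReal.ofReal (|M.Y n i ω'| ^ (1 + ε) + (∑ r, |M.T n i ω' r| ^ (1 + ε))
      + |bval (M.D n ω' i)| ^ (1 + ε))) ω < ∞
  /-- network dependence; finite path distances in row `n` are smaller than `n` -/
  decay : ∀ᵐ ω ∂μ, Tendsto
    (fun n : ℕ => (n : ℝ≥0∞)⁻¹ *
      ∑ s ∈ Finset.Icc 1 n, sphereAvg (M.A n ω) s * M.psiCoeff μ n s ω) atTop (𝓝 0)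
  /-- compact parameter space, on which the equilibrium is unique -/
  compact : IsCompact Θ
  peer : ∀ β ∈ Θ, |paramLam β| < 4
  /-- bounded Lipschitz moments on the support -/
  boundedLipschitz : ∀ β ∈ Θ, ∃ B L : ℝ, ∀ n i G x z w, (w, x, z) ∈ M.dataSupport μ n i G →
    ‖moment t t' G i w x z β‖ ≤ B ∧
    ∀ w', (w', x, z) ∈ M.dataSupport μ n i G →
      ‖moment t t' G i w x z β - moment t t' G i w' x z β‖ ≤ L * wDist w w'
  /-- uniform equicontinuity on the support -/
  equicontinuous : ∃ L : ℝ, 0 < L ∧ ∀ n i G x z w, (w, x, z) ∈ M.dataSupport μ n i G →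
    ∀ β ∈ Θ, ∀ β' ∈ Θ,
      ‖moment t t' G i w x z β - moment t t' G i w x z β'‖ ≤ L * ‖β - β'‖

/-- The weight matrices `Ξ̂_n` and their `C_n`-measurable counterparts `Ξ_n`. -/
structure WeightAssumption (Xihat Xi : ℕ → Ω → Matrix (PIdx kz kx) (PIdx kz kx) ℝ) : Prop where
  measurable_hat : ∀ n a b, Measurable fun ω => Xihat n ω a b
  posDef_hat : ∀ n, 1 ≤ n → ∀ᵐ ω ∂μ, (Xihat n ω).PosDef
  measurable_pop : ∀ n a b, Measurable[M.C n] fun ω => Xi n ω a b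
  posDef_pop : ∀ n, 1 ≤ n → ∀ᵐ ω ∂μ, (Xi n ω).PosDef
  bounded : ∀ᵐ ω ∂μ,
    (⨆ n : ℕ, ⨆ _ : 1 ≤ n, condLExp (M.C n) μ (fun ω' => ENNReal.ofReal (frob (Xihat n ω'))) ω) < ∞
  tendsto : ∀ᵐ ω ∂μ, Tendsto
    (fun n => condLExp (M.C n) μ (fun ω' => ENNReal.ofReal (frob (Xihat n ω' - Xi n ω'))) ω)
    atTop (𝓝 0)

/-- `β_0 ∈ Θ` solves the population moment equations in every row and is, asymptotically, the
well-separated minimiser of the population objective function on `Θ`: outside each ball around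
`β_0`, the functions `Q_n` stay above a positive (random) level for all large `n`. -/
structure IsIdentified (t t' : Expo q) (Θ : Set (Param kz kx))
    (Xi : ℕ → Ω → Matrix (PIdx kz kx) (PIdx kz kx) ℝ) (β₀ : Param kz kx) : Prop where
  mem : β₀ ∈ Θ
  moment_eq_zero : ∀ n, 1 ≤ n → ∀ᵐ ω ∂μ, M.gPop μ t t' n β₀ ω = 0
  separated : ∀ ε : ℝ, 0 < ε → ∃ κ : Ω → ℝ, (∀ᵐ ω ∂μ, 0 < κ ω) ∧
    ∀ β ∈ Θ, ε ≤ ‖β - β₀‖ → ∀ᵐ ω ∂μ, ∀ᶠ n in atTop, κ ω ≤ M.QPop μ t t' Xi n β ω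

end Probability

end NetworkModel

end NetworkGMM

end

/-!
Since `|λ| < 4`, the choice probabilities are the fixed point of a contraction, hence a function of
the common shocks alone, and given `C n` the treatment of a node depends on its own shock only. So
`W_{n,i}` with the treatments outside `N(i,s)` set to zero is a function of the shocks in `N(i,s)`,
which differs from `W_{n,i}` by the truncation error at radius `s`. The shocks are conditionally
independent and the `(s - 1) / 4`-neighbourhoods of two nodes at distance `s` are disjoint, so the
covariance of bounded Lipschitz moments of these nodes is at most a multiple of the truncation error
at that radius. Summing over all pairs bounds the conditional variance of `gHat n β` by the quantity
which the decay assumption sends to zero. The moments are Lipschitz on the support of the data only;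
off the support they are replaced by a Lipschitz extension.

For consistency, the part of `Θ` at distance at least `ε` from `β₀` is covered by finitely many
small balls. If the minimiser lies in one of them, with centre `β`, then comparing the sample
objective there with its value at `β₀` forces `QPop n β` to be at most a small constant plus a
bounded multiple of the errors in the moments at `β` and `β₀` and in the weights, whereas
identification keeps it above `κ`. Conditional Markov bounds for the finitely many centres show
that this event has conditional probability tending to zero, and dominated convergence removes the
conditioning.
-/

noncomputable section

namespace NetworkGMM

/-! ### Conditional Lebesgue expectations -/

section CondLExp

variable {Ω : Type*} {m m₀ : MeasurableSpace Ω} {μ : Measure[m₀] Ω}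

theorem condLExp_mul_of_measurable_left (hm : m ≤ m₀) [IsFiniteMeasure μ] {f g : Ω → ℝ≥0∞}
    (hf : Measurable[m] f) (hg : Measurable[m₀] g) :
    condLExp m μ (fun ω => f ω * g ω) =ᵐ[μ] fun ω => f ω * condLExp m μ g ω := by
  refine (ae_eq_condLExp hm μ _ (hf.mul (measurable_condLExp m μ g)) fun s hs => ?_).symm
  revert s
  refine Measurable.ennreal_induction (motive := fun f => ∀ s, MeasurableSet[m] s →
    ∫⁻ ω in s, f ω * condLExp m μ g ω ∂μ = ∫⁻ ω in s, f ω * g ω ∂μ)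
    (fun c t ht s hs => ?_) (fun f₁ f₂ _ hf₁ _ h₁ h₂ s hs => ?_) (fun f hf hmono h s hs => ?_) hf
  · simp only [← Set.indicator_mul_left]
    rw [setLIntegral_indicator (hm t ht), setLIntegral_indicator (hm t ht),
      lintegral_const_mul _ (measurable_condLExp' m μ g), lintegral_const_mul _ hg,
      setLIntegral_condLExp hm μ g (ht.inter hs)]
  · have hf₁' := hf₁.mono hm le_rfl
    simp only [Pi.add_apply, add_mul]
    rw [lintegral_add_left (hf₁'.fun_mul (measurable_condLExp' m μ g)),
      lintegral_add_left (hf₁'.fun_mul hg), h₁ s hs, h₂ s hs]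
  · have hf' := fun k => (hf k).mono hm le_rfl
    have hmono_mul (h : Ω → ℝ≥0∞) : Monotone fun k ω => f k ω * h ω := fun a b hab ω =>
      mul_le_mul_left (hmono hab ω) _
    simp only [ENNReal.iSup_mul]
    rw [lintegral_iSup (fun k => (hf' k).fun_mul (measurable_condLExp' m μ g)) (hmono_mul _),
      lintegral_iSup (fun k => (hf' k).fun_mul hg) (hmono_mul _)]
    exact iSup_congr fun k => h k s hs

theorem condLExp_indicator_one [IsFiniteMeasure μ] {s : Set Ω} (hs : MeasurableSet[m₀] s) :
    condLExp m μ (s.indicator 1) =ᵐ[μ] fun ω => ENNReal.ofReal ((μ⟦s | m⟧) ω) := by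
  have h_one : s.indicator (1 : Ω → ℝ≥0∞) =
      fun ω => ENNReal.ofReal (s.indicator (fun _ => (1 : ℝ)) ω) := by
    ext ω
    by_cases hω : ω ∈ s <;> simp [hω]
  rw [h_one]
  exact condLExp_ofReal m ((integrable_const _).indicator hs)
    (ae_of_all _ (Set.indicator_nonneg fun _ _ => zero_le_one))

theorem mul_condLExp_indicator_le (hm : m ≤ m₀) [IsFiniteMeasure μ] {F G U : Ω → ℝ≥0∞} {s : Set Ω}
    (hF : Measurable[m] F) (hG : Measurable[m] G) (hU : Measurable[m₀] U)
    (hs : MeasurableSet[m₀] s) (h : ∀ᵐ ω ∂μ, ω ∈ s → G ω ≤ F ω * U ω) :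
    ∀ᵐ ω ∂μ, G ω * condLExp m μ (s.indicator 1) ω ≤ F ω * condLExp m μ U ω := by
  have h_ind : (fun ω => G ω * s.indicator 1 ω) ≤ᵐ[μ] fun ω => F ω * U ω := by
    filter_upwards [h] with ω hω
    by_cases hωs : ω ∈ s
    · simpa [hωs] using hω hωs
    · simp [hωs]
  filter_upwards [condLExp_mono (mΩ := m) h_ind, condLExp_mul_of_measurable_left hm hF hU,
    condLExp_mul_of_measurable_left hm hG (measurable_one.indicator hs)] with ω h_le hFU hGs
  rwa [hGs, hFU] at h_le

theorem condLExp_indicator_le_sum {κ : Type*}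
    {s : Set Ω} {T : Finset κ} {A : κ → Set Ω} (hA : ∀ k, MeasurableSet[m₀] (A k))
    (h : ∀ᵐ ω ∂μ, ω ∈ s → ∃ k ∈ T, ω ∈ A k) :
    ∀ᵐ ω ∂μ, condLExp m μ (s.indicator 1) ω ≤ ∑ k ∈ T, condLExp m μ ((A k).indicator 1) ω := by
  have h_le : s.indicator (1 : Ω → ℝ≥0∞) ≤ᵐ[μ] ∑ k ∈ T, (A k).indicator 1 := by
    filter_upwards [h] with ω hω
    by_cases hωs : ω ∈ s
    · obtain ⟨k, hkT, hk⟩ := hω hωs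
      rw [Finset.sum_apply, Set.indicator_of_mem hωs]
      exact (Set.indicator_of_mem hk _).ge.trans
        (Finset.single_le_sum (f := fun k => (A k).indicator 1 ω) (fun _ _ => zero_le) hkT)
    · simp [hωs]
  filter_upwards [condLExp_mono (mΩ := m) h_le, condLExp_finsetSum m T fun k =>
    (measurable_one.indicator (hA k)).aemeasurable] with ω h_le h_sum
  simpa only [h_sum, Finset.sum_apply] using h_le

end CondLExp

theorem ae_eventually_of_eventually_ae {Ω : Type*} [MeasurableSpace Ω] {μ : Measure Ω}
    {p : ℕ → Ω → Prop} (h : ∀ᶠ n in atTop, ∀ᵐ ω ∂μ, p n ω) :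
    ∀ᵐ ω ∂μ, ∀ᶠ n in atTop, p n ω := by
  obtain ⟨N, hN⟩ := eventually_atTop.1 h
  filter_upwards [(ae_ball_iff (Set.to_countable {n | N ≤ n})).2 hN] with ω hω
  exact eventually_atTop.2 ⟨N, hω⟩

section TendstoInCondMean

variable {Ω : Type*} [MeasurableSpace Ω] {μ : Measure Ω} {C : ℕ → MeasurableSpace Ω}

/-- Almost sure convergence to zero of the conditional means of `f n` given `C n`, for a sequence
of `σ`-algebras that need not be monotone. -/
def TendstoInCondMean (μ : Measure Ω) (C : ℕ → MeasurableSpace Ω) (f : ℕ → Ω → ℝ≥0∞) : Prop :=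
  ∀ᵐ ω ∂μ, Tendsto (fun n => condLExp (C n) μ (f n) ω) atTop (𝓝 0)

namespace TendstoInCondMean

theorem add {f g : ℕ → Ω → ℝ≥0∞} (hf : TendstoInCondMean μ C f) (hg : TendstoInCondMean μ C g)
    (hfm : ∀ n, Measurable (f n)) : TendstoInCondMean μ C (f + g) := by
  filter_upwards [hf, hg, ae_all_iff.2 fun n => condLExp_add_left (mΩ := C n) (g n)
    (hfm n).aemeasurable] with ω hf hg h_add
  simpa [h_add] using hf.add hg

/-- A conditional Markov inequality, along a sequence of events `s n` on which `G n ≤ F n * U n`. -/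
theorem indicator_of_le_mul [IsFiniteMeasure μ] (hC : ∀ n, C n ≤ ‹MeasurableSpace Ω›)
    {F G U : ℕ → Ω → ℝ≥0∞} {s : ℕ → Set Ω} (hU₀ : TendstoInCondMean μ C U)
    (hF : ∀ n, Measurable[C n] (F n)) (hG : ∀ n, Measurable[C n] (G n))
    (hU : ∀ n, Measurable (U n)) (hs : ∀ n, MeasurableSet (s n))
    (h : ∀ᶠ n in atTop, ∀ᵐ ω ∂μ, ω ∈ s n → G n ω ≤ F n ω * U n ω) :
    ∀ᵐ ω ∂μ, ∀ R c : ℝ≥0∞, R ≠ ∞ → c ≠ 0 → c ≠ ∞ → (∀ᶠ n in atTop, F n ω ≤ R) →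
      (∀ᶠ n in atTop, c ≤ G n ω) →
      Tendsto (fun n => condLExp (C n) μ ((s n).indicator 1) ω) atTop (𝓝 0) := by
  have h_markov := ae_eventually_of_eventually_ae <| h.mono fun n hn =>
    mul_condLExp_indicator_le (hC n) (hF n) (hG n) (hU n) (hs n) hn
  filter_upwards [h_markov, hU₀] with ω h_markov hU₀ R c hR hc hc_top hFR hcG
  have h_lim : Tendsto (fun n => R * condLExp (C n) μ (U n) ω / c) atTop (𝓝 0) := by
    simpa using ENNReal.Tendsto.div_const (ENNReal.Tendsto.const_mul hU₀ (.inr hR)) (.inr hc)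
  refine tendsto_of_tendsto_of_tendsto_of_le_of_le' tendsto_const_nhds h_lim
    (.of_forall fun _ => zero_le) ?_
  filter_upwards [h_markov, hFR, hcG] with n h_markov hFR hcG
  rw [ENNReal.le_div_iff_mul_le (.inl hc) (.inl hc_top), mul_comm]
  exact (mul_le_mul_left hcG _).trans (h_markov.trans (mul_le_mul_left hFR _))

theorem tendsto_condExp [IsFiniteMeasure μ] {s : ℕ → Set Ω} (hs : ∀ n, MeasurableSet (s n))
    (h : TendstoInCondMean μ C fun n => (s n).indicator 1) :
    ∀ᵐ ω ∂μ, Tendsto (fun n => (μ⟦s n | C n⟧) ω) atTop (𝓝 0) := by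
  have h_nonneg (n : ℕ) : 0 ≤ᵐ[μ] μ⟦s n | C n⟧ :=
    condExp_nonneg (ae_of_all _ (Set.indicator_nonneg fun _ _ => zero_le_one))
  filter_upwards [h, ae_all_iff.2 fun n => condLExp_indicator_one (m := C n) (hs n),
    ae_all_iff.2 h_nonneg] with ω h h_eq h_nonneg
  simp only [h_eq] at h
  simpa [Function.comp_def, ENNReal.toReal_ofReal (h_nonneg _)] using
    (ENNReal.tendsto_toReal ENNReal.zero_ne_top).comp h

theorem tendsto_measure [IsFiniteMeasure μ] (hC : ∀ n, C n ≤ ‹MeasurableSpace Ω›)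
    {s : ℕ → Set Ω} (hs : ∀ n, MeasurableSet (s n))
    (h : TendstoInCondMean μ C fun n => (s n).indicator 1) :
    Tendsto (fun n => μ (s n)) atTop (𝓝 0) := by
  have h_le_one (n : ℕ) : condLExp (C n) μ ((s n).indicator 1) ≤ᵐ[μ] fun _ => 1 :=
    (condLExp_mono (ae_of_all _ (Set.indicator_le_self' fun _ _ => zero_le))).trans_eq
      (condLExp_one (hC n) μ).eventuallyEq
  have h_lim := tendsto_lintegral_of_dominated_convergence (fun _ => 1)
    (fun n => measurable_condLExp' (C n) μ ((s n).indicator 1)) h_le_one (by simp) h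
  simpa [lintegral_condLExp (hC _), lintegral_indicator (hs _)] using h_lim

end TendstoInCondMean

theorem tendstoInMeasure_of_tendstoInCondMean [IsFiniteMeasure μ]
    (hC : ∀ n, C n ≤ ‹MeasurableSpace Ω›) {E : Type*} [PseudoMetricSpace E] [MeasurableSpace E]
    [OpensMeasurableSpace E] {f : ℕ → Ω → E} (hf : ∀ n, Measurable (f n)) {a : E}
    (h : ∀ ε : ℝ, 0 < ε → TendstoInCondMean μ C fun n => {ω | ε < dist (f n ω) a}.indicator 1) :
    TendstoInMeasure μ f atTop fun _ => a := by
  refine tendstoInMeasure_iff_dist.2 fun ε hε => ?_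
  have h_far (n : ℕ) : MeasurableSet {ω | ε / 2 < dist (f n ω) a} :=
    hf n (measurableSet_lt measurable_const
      (continuous_id.dist continuous_const : Continuous fun x => dist x a).measurable)
  exact tendsto_of_tendsto_of_tendsto_of_le_of_le tendsto_const_nhds
    ((h _ (half_pos hε)).tendsto_measure hC h_far) (fun _ => zero_le)
    fun n => measure_mono fun ω hω => (half_lt_self hε).trans_le hω

end TendstoInCondMean

/-! ### Quadratic forms and the Frobenius norm -/

section Frobenius

variable {ι : Type*} [Fintype ι]

theorem frob_eq_norm_toLp (A : Matrix ι ι ℝ) :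
    frob A = ‖(WithLp.toLp 2 fun p : ι × ι => A p.1 p.2 : EuclideanSpace ℝ (ι × ι))‖ := by
  rw [frob, EuclideanSpace.norm_eq, Fintype.sum_prod_type_right]
  simp [Matrix.trace, Matrix.mul_apply, sq]

theorem frob_nonneg (A : Matrix ι ι ℝ) : 0 ≤ frob A := Real.sqrt_nonneg _

theorem frob_le_frob_sub_add (A A' : Matrix ι ι ℝ) : frob A ≤ frob (A' - A) + frob A' := by
  simp only [frob_eq_norm_toLp]
  refine (norm_le_norm_sub_add _ (WithLp.toLp 2 fun p : ι × ι => A' p.1 p.2)).trans_eq ?_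
  rw [norm_sub_rev]
  rfl

theorem measurable_frob {α : Type*} {_ : MeasurableSpace α} {A : α → Matrix ι ι ℝ}
    (hA : ∀ i j, Measurable fun a => A a i j) : Measurable fun a => frob (A a) := by
  simp only [frob, Matrix.trace, Matrix.diag_apply, Matrix.mul_apply, Matrix.transpose_apply]
  fun_prop

theorem measurable_quad {α : Type*} {_ : MeasurableSpace α} {A : α → Matrix ι ι ℝ}
    {v : α → EuclideanSpace ℝ ι} (hA : ∀ i j, Measurable fun a => A a i j) (hv : Measurable v) :
    Measurable fun a => quad (A a) (v a) := by
  have (i : ι) : Measurable fun a => v a i := by fun_prop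
  simp only [quad]
  fun_prop

theorem abs_bilin_le (A : Matrix ι ι ℝ) (u v : EuclideanSpace ℝ ι) :
    |∑ a, ∑ b, u a * A a b * v b| ≤ frob A * (‖u‖ * ‖v‖) := by
  have h_sum : ∑ a, ∑ b, u a * A a b * v b = ∑ p : ι × ι, A p.1 p.2 * (u p.1 * v p.2) := by
    rw [Fintype.sum_prod_type]
    exact Finset.sum_congr rfl fun a _ => Finset.sum_congr rfl fun b _ => by ring
  have h_tensor : ∑ p : ι × ι, (u p.1 * v p.2) ^ 2 = (‖u‖ * ‖v‖) ^ 2 := by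
    rw [mul_pow, EuclideanSpace.real_norm_sq_eq, EuclideanSpace.real_norm_sq_eq,
      Finset.sum_mul_sum, Fintype.sum_prod_type]
    simp [mul_pow]
  have h_frob : ∑ p : ι × ι, A p.1 p.2 ^ 2 = frob A ^ 2 := by
    rw [frob_eq_norm_toLp, EuclideanSpace.real_norm_sq_eq]
  rw [h_sum]
  refine abs_le_of_sq_le_sq ?_ (mul_nonneg (frob_nonneg A) (by positivity))
  rw [mul_pow, ← h_tensor, ← h_frob]
  exact Finset.sum_mul_sq_le_sq_mul_sq _ _ _

theorem abs_quad_le (A : Matrix ι ι ℝ) (v : EuclideanSpace ℝ ι) :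
    |quad A v| ≤ frob A * ‖v‖ ^ 2 := by
  rw [sq]; exact abs_bilin_le A v v

theorem abs_quad_sub_quad_le (A : Matrix ι ι ℝ) {u v : EuclideanSpace ℝ ι} {B : ℝ}
    (hu : ‖u‖ ≤ B) (hv : ‖v‖ ≤ B) : |quad A u - quad A v| ≤ 2 * B * frob A * ‖u - v‖ := by
  have h_polar : quad A u - quad A v = (∑ a, ∑ b, (u - v) a * A a b * u b)
      + ∑ a, ∑ b, v a * A a b * (u - v) b := by
    simp only [quad, ← Finset.sum_add_distrib, ← Finset.sum_sub_distrib, PiLp.sub_apply]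
    exact Finset.sum_congr rfl fun a _ => Finset.sum_congr rfl fun b _ => by ring
  have hA := frob_nonneg A
  calc |quad A u - quad A v|
      ≤ frob A * (‖u - v‖ * ‖u‖) + frob A * (‖v‖ * ‖u - v‖) := by
        rw [h_polar]
        exact (abs_add_le _ _).trans (add_le_add (abs_bilin_le A _ _) (abs_bilin_le A _ _))
    _ ≤ frob A * (‖u - v‖ * B) + frob A * (B * ‖u - v‖) := by gcongr
    _ = 2 * B * frob A * ‖u - v‖ := by ring

theorem abs_quad_sub_le (A A' : Matrix ι ι ℝ) {v : EuclideanSpace ℝ ι} {B : ℝ} (hv : ‖v‖ ≤ B) :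
    |quad A' v - quad A v| ≤ B ^ 2 * frob (A' - A) := by
  have h_sub : quad A' v - quad A v = quad (A' - A) v := by
    simp only [quad, ← Finset.sum_sub_distrib, Matrix.sub_apply]
    exact Finset.sum_congr rfl fun a _ => Finset.sum_congr rfl fun b _ => by ring
  have hA := frob_nonneg (A' - A)
  calc |quad A' v - quad A v| ≤ frob (A' - A) * ‖v‖ ^ 2 := h_sub ▸ abs_quad_le _ _
    _ ≤ frob (A' - A) * B ^ 2 := by gcongr
    _ = B ^ 2 * frob (A' - A) := mul_comm _ _

/-- With `A`, `A'` the population and the sample weights: if the sample objective at moments `h`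
is at most the one at `g₀`, then the population objective is small at all moments `g` whose sample
version `g'` is close to `h`. -/
theorem quad_le_of_quad_le {A A' : Matrix ι ι ℝ} {g g' h g₀ : EuclideanSpace ℝ ι} {B d : ℝ}
    (hg : ‖g‖ ≤ B) (hg' : ‖g'‖ ≤ B) (hh : ‖h‖ ≤ B) (hg₀ : ‖g₀‖ ≤ B) (hd : ‖g' - h‖ ≤ d)
    (hmin : quad A' h ≤ quad A' g₀) :
    quad A g - 2 * B * frob A * d ≤
      (2 * B * frob A + 2 * B ^ 2) * (‖g' - g‖ + ‖g₀‖ + frob (A' - A)) := by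
  have hB : 0 ≤ B := (norm_nonneg _).trans hg
  have hA := frob_nonneg A
  have hAA' := frob_nonneg (A' - A)
  have h_move : quad A g - quad A g' ≤ 2 * B * frob A * ‖g' - g‖ :=
    norm_sub_rev g g' ▸ (le_abs_self _).trans (abs_quad_sub_quad_le A hg hg')
  have h_near : quad A g' - quad A h ≤ 2 * B * frob A * d :=
    (le_abs_self _).trans ((abs_quad_sub_quad_le A hg' hh).trans (by gcongr))
  have h_weight : quad A h - quad A' h ≤ B ^ 2 * frob (A' - A) :=
    (le_abs_self _).trans (abs_sub_comm (quad A h) _ ▸ abs_quad_sub_le A A' hh)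
  have h_weight₀ : quad A' g₀ - quad A g₀ ≤ B ^ 2 * frob (A' - A) :=
    (le_abs_self _).trans (abs_quad_sub_le A A' hg₀)
  have h_zero : quad A g₀ ≤ 2 * B * frob A * ‖g₀‖ := by
    have hB₀ : ‖(0 : EuclideanSpace ℝ ι)‖ ≤ B := by simpa using hB
    simpa [quad] using (le_abs_self _).trans (abs_quad_sub_quad_le A hg₀ hB₀)
  have h_cross : 0 ≤ 2 * B * frob A * frob (A' - A) + 2 * B ^ 2 * (‖g' - g‖ + ‖g₀‖) := by
    positivity
  linarith

end Frobenius

/-! ### Consistency of minimum distance estimators -/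

section GMM

variable {Ω ι E : Type*} [MeasurableSpace Ω] [Fintype ι] {μ : Measure Ω}
  {C : ℕ → MeasurableSpace Ω}

/-- Random weight matrices that are bounded and close to `C n`-measurable ones in conditional
mean. -/
structure ConvergentWeights (μ : Measure Ω) (C : ℕ → MeasurableSpace Ω)
    (What W : ℕ → Ω → Matrix ι ι ℝ) : Prop where
  measurable_hat : ∀ n a b, Measurable fun ω => What n ω a b
  measurable_pop : ∀ n a b, Measurable[C n] fun ω => W n ω a b
  bounded : ∀ᵐ ω ∂μ,
    (⨆ n : ℕ, ⨆ _ : 1 ≤ n, condLExp (C n) μ (fun ω' => ENNReal.ofReal (frob (What n ω'))) ω) < ∞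
  tendsto : TendstoInCondMean μ C fun n ω => ENNReal.ofReal (frob (What n ω - W n ω))

theorem ConvergentWeights.ofReal_frob_le [IsFiniteMeasure μ] (hC : ∀ n, C n ≤ ‹MeasurableSpace Ω›)
    {What W : ℕ → Ω → Matrix ι ι ℝ} (hW : ConvergentWeights μ C What W) (n : ℕ) :
    ∀ᵐ ω ∂μ, ENNReal.ofReal (frob (W n ω)) ≤
      condLExp (C n) μ (fun ω' => ENNReal.ofReal (frob (What n ω' - W n ω'))) ω
        + condLExp (C n) μ (fun ω' => ENNReal.ofReal (frob (What n ω'))) ω := by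
  have h_triangle : (fun ω => ENNReal.ofReal (frob (W n ω))) ≤
      (fun ω => ENNReal.ofReal (frob (What n ω - W n ω)))
        + fun ω => ENNReal.ofReal (frob (What n ω)) := fun ω => by
    simp only [Pi.add_apply]
    rw [← ENNReal.ofReal_add (frob_nonneg _) (frob_nonneg _)]
    exact ENNReal.ofReal_le_ofReal (frob_le_frob_sub_add _ _)
  filter_upwards [condLExp_mono (mΩ := C n) (ae_of_all μ h_triangle),
    condLExp_add_right (mΩ := C n) _
      (measurable_frob (hW.measurable_hat n)).ennreal_ofReal.aemeasurable] with ω h_le h_add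
  rwa [h_add, condLExp_eq_self (hC n) μ (measurable_frob (hW.measurable_pop n)).ennreal_ofReal]
    at h_le

theorem ConvergentWeights.ae_eventually_frob_le [IsFiniteMeasure μ]
    (hC : ∀ n, C n ≤ ‹MeasurableSpace Ω›) {What W : ℕ → Ω → Matrix ι ι ℝ}
    (hW : ConvergentWeights μ C What W) :
    ∀ᵐ ω ∂μ, ∃ R : ℝ, ∀ᶠ n in atTop, frob (W n ω) ≤ R := by
  filter_upwards [ae_all_iff.2 (hW.ofReal_frob_le hC), hW.bounded, hW.tendsto]
    with ω h_le h_bdd h_lim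
  set S := ⨆ n : ℕ, ⨆ _ : 1 ≤ n, condLExp (C n) μ (fun ω' => ENNReal.ofReal (frob (What n ω'))) ω
    with hS
  refine ⟨(1 + S).toReal, ?_⟩
  filter_upwards [ENNReal.tendsto_nhds_zero.1 h_lim 1 one_pos, eventually_ge_atTop 1]
    with n h_near hn
  have h_sup : condLExp (C n) μ (fun ω' => ENNReal.ofReal (frob (What n ω'))) ω ≤ S :=
    hS ▸ le_iSup₂_of_le n hn le_rfl
  rw [← ENNReal.ofReal_le_iff_le_toReal (ENNReal.add_ne_top.2 ⟨ENNReal.one_ne_top, h_bdd.ne⟩)]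
  exact (h_le n).trans (add_le_add h_near h_sup)

variable [PseudoMetricSpace E] [MeasurableSpace E]

/-- Sample moments `gHat n β` and population moments `g n β` given `C n`, bounded by `B`, with
sample moments that are `L`-Lipschitz in the parameter `β ∈ Θ` and obey, at each parameter, a
conditional law of large numbers. -/
structure RegularMoments (μ : Measure Ω) (C : ℕ → MeasurableSpace Ω) (Θ : Set E)
    (gHat g : ℕ → E → Ω → EuclideanSpace ℝ ι) (B L : NNReal) : Prop where
  le : ∀ n, C n ≤ ‹MeasurableSpace Ω›
  measurable_hat : ∀ n, ∀ β ∈ Θ, Measurable (gHat n β)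
  measurable_pop : ∀ n, ∀ β ∈ Θ, Measurable[C n] (g n β)
  norm_hat_le : ∀ n, ∀ᵐ ω ∂μ, ∀ β ∈ Θ, ‖gHat n β ω‖ ≤ B
  norm_pop_le : ∀ n, ∀ β ∈ Θ, ∀ᵐ ω ∂μ, ‖g n β ω‖ ≤ B
  lipschitz : ∀ n, ∀ᵐ ω ∂μ, LipschitzOnWith L (fun β => gHat n β ω) Θ
  lln : ∀ β ∈ Θ, TendstoInCondMean μ C fun n ω => ENNReal.ofReal ‖gHat n β ω - g n β ω‖

/-- `βhat n` is eventually a measurable minimiser over `Θ` of the weighted norm of the sample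
moments. -/
structure IsMinimumDistance (μ : Measure Ω) (Θ : Set E) (gHat : ℕ → E → Ω → EuclideanSpace ℝ ι)
    (What : ℕ → Ω → Matrix ι ι ℝ) (βhat : ℕ → Ω → E) : Prop where
  measurable : ∀ n, Measurable (βhat n)
  minimises : ∀ᶠ n in atTop, ∀ᵐ ω ∂μ, βhat n ω ∈ Θ ∧
    ∀ β ∈ Θ, quad (What n ω) (gHat n (βhat n ω) ω) ≤ quad (What n ω) (gHat n β ω)

variable {Θ : Set E} {gHat g : ℕ → E → Ω → EuclideanSpace ℝ ι}
  {What W : ℕ → Ω → Matrix ι ι ℝ} {βhat : ℕ → Ω → E} {B L : NNReal} {β₀ : E}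

theorem IsMinimumDistance.ae_quad_le (hg : RegularMoments μ C Θ gHat g B L)
    (hβ : IsMinimumDistance μ Θ gHat What βhat) (hβ₀ : β₀ ∈ Θ)
    (h_zero : ∀ᶠ n in atTop, ∀ᵐ ω ∂μ, g n β₀ ω = 0) {β : E} (hβΘ : β ∈ Θ) (d : ℝ) :
    ∀ᶠ n in atTop, ∀ᵐ ω ∂μ, ω ∈ βhat n ⁻¹' Metric.closedBall β d →
      quad (W n ω) (g n β ω) - 2 * B * frob (W n ω) * (L * d) ≤
        (2 * B * frob (W n ω) + 2 * B ^ 2) * (‖gHat n β ω - g n β ω‖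
          + ‖gHat n β₀ ω - g n β₀ ω‖ + frob (What n ω - W n ω)) := by
  filter_upwards [hβ.minimises, h_zero] with n h_min h_zero
  filter_upwards [h_min, h_zero, hg.norm_hat_le n, hg.norm_pop_le n β hβΘ, hg.lipschitz n]
    with ω ⟨h_mem, h_min⟩ h_zero h_hat h_pop h_lip h_ball
  have h_dist : ‖gHat n β ω - gHat n (βhat n ω) ω‖ ≤ L * d := by
    rw [← dist_eq_norm]
    exact (h_lip.dist_le_mul β hβΘ _ h_mem).trans
      (mul_le_mul_of_nonneg_left (Metric.mem_closedBall'.1 h_ball) L.2)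
  rw [h_zero, sub_zero]
  exact quad_le_of_quad_le h_pop (h_hat β hβΘ) (h_hat _ h_mem) (h_hat β₀ hβ₀) h_dist
    (h_min β₀ hβ₀)

variable [OpensMeasurableSpace E]

theorem IsMinimumDistance.tendsto_condLExp_closedBall [IsFiniteMeasure μ]
    (hg : RegularMoments μ C Θ gHat g B L) (hW : ConvergentWeights μ C What W)
    (hβ : IsMinimumDistance μ Θ gHat What βhat) (hβ₀ : β₀ ∈ Θ)
    (h_zero : ∀ᶠ n in atTop, ∀ᵐ ω ∂μ, g n β₀ ω = 0) {β : E} (hβΘ : β ∈ Θ) (d : ℝ) :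
    ∀ᵐ ω ∂μ, ∀ R c : ℝ, 0 < c → (∀ᶠ n in atTop, frob (W n ω) ≤ R) →
      (∀ᶠ n in atTop, c ≤ quad (W n ω) (g n β ω) - 2 * B * frob (W n ω) * (L * d)) →
      Tendsto (fun n => condLExp (C n) μ ((βhat n ⁻¹' Metric.closedBall β d).indicator 1) ω)
        atTop (𝓝 0) := by
  have h_frob_meas n : Measurable[C n] fun ω => frob (W n ω) :=
    measurable_frob (hW.measurable_pop n)
  have h_dev_meas {b : E} (hb : b ∈ Θ) (n : ℕ) :
      Measurable fun ω => ENNReal.ofReal ‖gHat n b ω - g n b ω‖ :=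
    ((hg.measurable_hat n b hb).sub
      ((hg.measurable_pop n b hb).mono (hg.le n) le_rfl)).norm.ennreal_ofReal
  have h_weight_meas n : Measurable fun ω => ENNReal.ofReal (frob (What n ω - W n ω)) :=
    (measurable_frob fun a b => (hW.measurable_hat n a b).sub
      ((hW.measurable_pop n a b).mono (hg.le n) le_rfl)).ennreal_ofReal
  have h_markov := TendstoInCondMean.indicator_of_le_mul hg.le
    (((hg.lln β hβΘ).add (hg.lln β₀ hβ₀) (h_dev_meas hβΘ)).add hW.tendsto
      fun n => (h_dev_meas hβΘ n).add (h_dev_meas hβ₀ n))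
    (F := fun n ω => ENNReal.ofReal (2 * B * frob (W n ω) + 2 * B ^ 2))
    (G := fun n ω => ENNReal.ofReal
      (quad (W n ω) (g n β ω) - 2 * B * frob (W n ω) * (L * d)))
    (s := fun n => βhat n ⁻¹' Metric.closedBall β d)
    (fun n => (((h_frob_meas n).const_mul _).add_const _).ennreal_ofReal)
    (fun n => ((measurable_quad (hW.measurable_pop n) (hg.measurable_pop n β hβΘ)).sub
      (((h_frob_meas n).const_mul _).mul_const _)).ennreal_ofReal)
    (fun n => ((h_dev_meas hβΘ n).add (h_dev_meas hβ₀ n)).add (h_weight_meas n))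
    (fun n => hβ.measurable n Metric.isClosed_closedBall.measurableSet) ?_
  · filter_upwards [h_markov] with ω h_markov R c hc hR h_sep
    refine h_markov (ENNReal.ofReal (2 * B * R + 2 * B ^ 2)) (ENNReal.ofReal c)
      ENNReal.ofReal_ne_top (ENNReal.ofReal_pos.2 hc).ne' ENNReal.ofReal_ne_top
      (hR.mono fun n hn => ENNReal.ofReal_le_ofReal (by gcongr))
      (h_sep.mono fun n hn => ENNReal.ofReal_le_ofReal hn)
  · filter_upwards [hβ.ae_quad_le (W := W) hg hβ₀ h_zero hβΘ d] with n hn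
    filter_upwards [hn] with ω hω h_ball
    have h_frob := frob_nonneg (W n ω)
    simp only [Pi.add_apply]
    rw [← ENNReal.ofReal_add (norm_nonneg _) (norm_nonneg _),
      ← ENNReal.ofReal_add (by positivity) (frob_nonneg _), ← ENNReal.ofReal_mul (by positivity)]
    exact ENNReal.ofReal_le_ofReal (hω h_ball)

theorem IsMinimumDistance.ae_eventually_condLExp_far_le_sum
    (hβ : IsMinimumDistance μ Θ gHat What βhat) {ε d : ℝ} {T : Finset E}
    (hT : Θ ∩ {β | ε ≤ dist β β₀} ⊆ ⋃ β ∈ T, Metric.ball β d) :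
    ∀ᵐ ω ∂μ, ∀ᶠ n in atTop,
      condLExp (C n) μ ({ω' | ε < dist (βhat n ω') β₀}.indicator 1) ω ≤
        ∑ β ∈ T, condLExp (C n) μ ((βhat n ⁻¹' Metric.closedBall β d).indicator 1) ω := by
  refine ae_eventually_of_eventually_ae (hβ.minimises.mono fun n hn =>
    condLExp_indicator_le_sum
      (fun β => hβ.measurable n Metric.isClosed_closedBall.measurableSet) ?_)
  filter_upwards [hn] with ω hω h_far
  obtain ⟨β, hβT, h_ball⟩ := Set.mem_iUnion₂.1 (hT ⟨hω.1, le_of_lt h_far⟩)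
  exact ⟨β, hβT, Metric.ball_subset_closedBall h_ball⟩

theorem exists_nat_div_add_one_le (a : ℝ) {c : ℝ} (hc : 0 < c) : ∃ m : ℕ, a / (m + 1) ≤ c := by
  obtain ⟨m, hm⟩ := exists_nat_gt (a / c)
  refine ⟨m, (div_le_iff₀ (by positivity)).2 ?_⟩
  have := (div_lt_iff₀ hc).1 hm
  linarith

/-- Outside each ball around `β₀`, the compact parameter space is covered by finitely many balls so
small that the objective cannot drop below half the separation level `κ` near a centre. The
admissible radius is random, hence the countable family of covers. -/
theorem IsMinimumDistance.tendstoInCondMean [IsFiniteMeasure μ] (hΘ : IsCompact Θ)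
    (hg : RegularMoments μ C Θ gHat g B L) (hW : ConvergentWeights μ C What W)
    (hβ : IsMinimumDistance μ Θ gHat What βhat) (hβ₀ : β₀ ∈ Θ)
    (h_zero : ∀ᶠ n in atTop, ∀ᵐ ω ∂μ, g n β₀ ω = 0) {ε : ℝ} {κ : Ω → ℝ}
    (hκ : ∀ᵐ ω ∂μ, 0 < κ ω) (h_sep : ∀ β ∈ Θ, ε ≤ dist β β₀ →
      ∀ᵐ ω ∂μ, ∀ᶠ n in atTop, κ ω ≤ quad (W n ω) (g n β ω)) :
    TendstoInCondMean μ C fun n => {ω | ε < dist (βhat n ω) β₀}.indicator 1 := by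
  have h_compact : IsCompact (Θ ∩ {β | ε ≤ dist β β₀}) :=
    hΘ.inter_right (isClosed_le continuous_const (continuous_id.dist continuous_const))
  choose T hT hT_fin hT_cover using fun m : ℕ =>
    h_compact.finite_cover_balls (e := 1 / ((m : ℝ) + 1)) Nat.one_div_pos_of_nat
  have h_far (m : ℕ) := hβ.ae_eventually_condLExp_far_le_sum (C := C) (T := (hT_fin m).toFinset)
    (by simpa only [Set.Finite.mem_toFinset] using hT_cover m)
  have h_near (m : ℕ) := (ae_ball_iff (hT_fin m).countable).2 fun β hβT =>
    hβ.tendsto_condLExp_closedBall hg hW hβ₀ h_zero (hT m hβT).1 (1 / ((m : ℝ) + 1))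
  have h_above (m : ℕ) := (ae_ball_iff (hT_fin m).countable).2
    fun β hβT => h_sep β (hT m hβT).1 (hT m hβT).2
  filter_upwards [ae_all_iff.2 h_far, ae_all_iff.2 h_near, ae_all_iff.2 h_above, hκ,
    hW.ae_eventually_frob_le hg.le] with ω h_far h_near h_above hκ ⟨R, h_frob⟩
  obtain ⟨m, hm⟩ := exists_nat_div_add_one_le (2 * B * R * L) (half_pos hκ)
  have h_sum : Tendsto (fun n => ∑ β ∈ (hT_fin m).toFinset, condLExp (C n) μ
      ((βhat n ⁻¹' Metric.closedBall β (1 / ((m : ℝ) + 1))).indicator 1) ω) atTop (𝓝 0) := by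
    rw [← Finset.sum_const_zero (s := (hT_fin m).toFinset)]
    refine tendsto_finsetSum _ fun β hβT => ?_
    replace hβT := (hT_fin m).mem_toFinset.1 hβT
    refine h_near m β hβT R (κ ω / 2) (half_pos hκ) h_frob ?_
    filter_upwards [h_above m β hβT, h_frob] with n h_above h_frob
    have h_drop : 2 * B * frob (W n ω) * (L * (1 / ((m : ℝ) + 1))) ≤ 2 * B * R * L / (m + 1) := by
      rw [← mul_assoc, mul_one_div]
      gcongr
    linarith
  exact tendsto_of_tendsto_of_tendsto_of_le_of_le' tendsto_const_nhds h_sum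
    (.of_forall fun _ => zero_le) (h_far m)

end GMM

/-! ### Regular conditional distributions -/

section CondDistrib

variable {Ω β E : Type*} [MeasurableSpace Ω] [mβ : MeasurableSpace β] [MeasurableSpace E]
  [StandardBorelSpace E] [Nonempty E] {μ : Measure Ω} [IsFiniteMeasure μ] {X : Ω → β}

theorem condLExp_ae_eq_lintegral_condDistrib {U : Ω → E} (hX : Measurable X) (hU : Measurable U)
    {F : β × E → ℝ≥0∞} (hF : Measurable F) :
    condLExp (mβ.comap X) μ (fun ω => F (X ω, U ω)) =ᵐ[μ]
      fun ω => ∫⁻ u, F (X ω, u) ∂condDistrib U X μ (X ω) := by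
  have hG : Measurable fun b => ∫⁻ u, F (b, u) ∂condDistrib U X μ b :=
    hF.lintegral_kernel_prod_right'
  refine (ae_eq_condLExp hX.comap_le μ _ (hG.comp (comap_measurable X)) ?_).symm
  rintro _ ⟨t, ht, rfl⟩
  calc ∫⁻ ω in X ⁻¹' t, ∫⁻ u, F (X ω, u) ∂condDistrib U X μ (X ω) ∂μ
      = ∫⁻ b in t, ∫⁻ u, F (b, u) ∂condDistrib U X μ b ∂(μ.map X) :=
        (setLIntegral_map ht hG hX).symm
    _ = ∫⁻ p in t ×ˢ Set.univ, F p ∂(μ.map fun ω => (X ω, U ω)) := by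
        rw [← compProd_map_condDistrib hU.aemeasurable,
          Measure.setLIntegral_compProd hF ht MeasurableSet.univ]
        simp only [Measure.restrict_univ]
    _ = ∫⁻ ω in X ⁻¹' t, F (X ω, U ω) ∂μ := by
        rw [setLIntegral_map (ht.prod MeasurableSet.univ) hF (hX.prodMk hU), Set.mk_preimage_prod,
          Set.preimage_univ, Set.inter_univ]

theorem ae_ae_condDistrib {U : Ω → E} (hX : Measurable X) (hU : Measurable U) {p : β × E → Prop}
    (hp : MeasurableSet {x | p x}) (h : ∀ᵐ ω ∂μ, p (X ω, U ω)) :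
    ∀ᵐ ω ∂μ, ∀ᵐ u ∂condDistrib U X μ (X ω), p (X ω, u) := by
  refine ae_of_ae_map hX.aemeasurable (p := fun b => ∀ᵐ u ∂condDistrib U X μ b, p (b, u)) ?_
  apply Measure.ae_ae_of_ae_compProd
  rwa [compProd_map_condDistrib hU.aemeasurable, ae_map_iff (hX.prodMk hU).aemeasurable hp]

variable {ι : Type*} [Fintype ι] {U : Ω → ι → E}

theorem ae_condDistrib_pi_eq_prod (hX : Measurable X) (hU : Measurable U)
    (h : CondIndepFamily (mβ.comap X) μ fun i ω => U ω i) {s : ι → Set E}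
    (hs : ∀ i, MeasurableSet (s i)) :
    ∀ᵐ ω ∂μ, condDistrib U X μ (X ω) (Set.univ.pi s) =
      ∏ i, (condDistrib U X μ (X ω)).map (Function.eval i) (s i) := by
  have h_coord : ∀ᵐ ω ∂μ, ∀ i, (condDistrib U X μ (X ω)).real (Function.eval i ⁻¹' s i) =
      (μ⟦U ⁻¹' (Function.eval i ⁻¹' s i) | mβ.comap X⟧) ω :=
    ae_all_iff.2 fun i => condDistrib_ae_eq_condExp hX hU (measurable_pi_apply i (hs i))
  filter_upwards [h s hs, h_coord, condDistrib_ae_eq_condExp (μ := μ) hX hU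
    (MeasurableSet.univ_pi hs)] with ω h_indep h_coord h_pi
  have h_real : (condDistrib U X μ (X ω)).real (Set.univ.pi s) =
      ∏ i, (condDistrib U X μ (X ω)).real (Function.eval i ⁻¹' s i) := by
    rw [h_pi, Finset.prod_congr rfl fun i _ => h_coord i, Set.univ_pi_eq_iInter,
      Set.preimage_iInter]
    exact h_indep
  rw [Finset.prod_congr rfl fun i _ => Measure.map_apply (measurable_pi_apply i) (hs i)]
  rw [← ENNReal.toReal_eq_toReal_iff' (measure_ne_top _ _)
    (ENNReal.prod_ne_top fun i _ => measure_ne_top _ _), ENNReal.toReal_prod]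
  exact h_real

/-- The product formula holds simultaneously on the boxes with sides in a countable algebra that
generates the `σ`-algebra. -/
theorem iIndepFun_condDistrib (hX : Measurable X) (hU : Measurable U)
    (h : CondIndepFamily (mβ.comap X) μ fun i ω => U ω i) :
    ∀ᵐ ω ∂μ, iIndepFun (fun (i : ι) (u : ι → E) => u i) (condDistrib U X μ (X ω)) := by
  set S : Set (Set E) := generateSetAlgebra (MeasurableSpace.countableGeneratingSet E) with hS
  have hS_countable : Countable S :=
    (countable_generateSetAlgebra MeasurableSpace.countable_countableGeneratingSet).to_subtype
  have hS_gen : MeasurableSpace.generateFrom S = ‹MeasurableSpace E› := by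
    rw [hS, generateFrom_generateSetAlgebra_eq, MeasurableSpace.generateFrom_countableGeneratingSet]
  have hS_alg : IsSetAlgebra S := isSetAlgebra_generateSetAlgebra
  have hS_meas (s : S) : MeasurableSet (s : Set E) :=
    hS_gen ▸ MeasurableSpace.measurableSet_generateFrom s.2
  filter_upwards [ae_all_iff.2 fun s : ι → S =>
    ae_condDistrib_pi_eq_prod hX hU h fun i => hS_meas (s i)] with ω hω
  rw [iIndepFun_iff_map_fun_eq_pi_map fun i => (measurable_pi_apply i).aemeasurable]
  refine Measure.map_id.trans (Measure.pi_eq_generateFrom (C := fun _ => S) (fun _ => hS_gen)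
    (fun _ s hs t ht _ => hS_alg.inter_mem hs ht)
    (fun _ => ⟨fun _ => Set.univ, fun _ => hS_alg.univ_mem, fun _ => measure_lt_top _ _,
      Set.iUnion_const _⟩) fun s hs => hω fun i => ⟨s i, hs i⟩).symm

end CondDistrib

/-! ### Covariances of approximately local functions -/

section Covariance

theorem abs_covariance_le {Ω : Type*} [MeasurableSpace Ω] {ρ : Measure Ω} [IsProbabilityMeasure ρ]
    {h g : Ω → ℝ} {B : ℝ} (hh : MemLp h 2 ρ) (hg : MemLp g 2 ρ) (hgB : ∀ ω, |g ω| ≤ B) :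
    |cov[h, g; ρ]| ≤ 2 * B * ∫ ω, |h ω| ∂ρ := by
  have h_mean : |∫ ω, g ω ∂ρ| ≤ B := by
    simpa using norm_integral_le_of_norm_le_const (μ := ρ) (f := g) (ae_of_all _ hgB)
  have h_prod : |∫ ω, h ω * g ω ∂ρ| ≤ B * ∫ ω, |h ω| ∂ρ := by
    rw [← integral_const_mul]
    refine abs_integral_le_integral_abs.trans (integral_mono_of_nonneg
      (ae_of_all _ fun _ => abs_nonneg _) ((hh.integrable one_le_two).abs.const_mul B)
      (ae_of_all _ fun ω => ?_))
    simpa only [abs_mul, mul_comm B] using mul_le_mul_of_nonneg_left (hgB ω) (abs_nonneg (h ω))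
  calc |cov[h, g; ρ]| ≤ |∫ ω, h ω * g ω ∂ρ| + |∫ ω, h ω ∂ρ| * |∫ ω, g ω ∂ρ| := by
        rw [covariance_eq_sub hh hg, ← abs_mul]; exact abs_sub _ _
    _ ≤ B * ∫ ω, |h ω| ∂ρ + (∫ ω, |h ω| ∂ρ) * B := by
        gcongr
        exact abs_integral_le_integral_abs
    _ = 2 * B * ∫ ω, |h ω| ∂ρ := by ring

variable {ι E : Type*} [MeasurableSpace E] [Nonempty E] {ρ : Measure (ι → E)}

theorem indepFun_of_dependsOn {F : Type*} [MeasurableSpace F]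
    (hρ : iIndepFun (fun (i : ι) (u : ι → E) => u i) ρ) {S T : Finset ι} (hST : Disjoint S T)
    {f g : (ι → E) → F} (hf : Measurable f) (hg : Measurable g) (hS : DependsOn f (S : Set ι))
    (hT : DependsOn g (T : Set ι)) : IndepFun f g ρ := by
  classical
  obtain ⟨u₀⟩ : Nonempty (ι → E) := inferInstance
  have h_factor {R : Finset ι} {h : (ι → E) → F} (hR : DependsOn h (R : Set ι)) :
      (fun v => h (Function.updateFinset u₀ R v)) ∘ (fun u (i : R) => u i) = h :=
    funext fun u => hR fun i hi => by
      simp [Function.updateFinset, Finset.mem_coe.1 hi]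
  rw [← h_factor hS, ← h_factor hT]
  exact (hρ.indepFun_finset S T hST fun i => measurable_pi_apply i).comp
    (hf.comp measurable_updateFinset) (hg.comp measurable_updateFinset)

theorem ofReal_abs_covariance_le [IsProbabilityMeasure ρ]
    (hρ : iIndepFun (fun (i : ι) (u : ι → E) => u i) ρ) {S T : Finset ι} (hST : Disjoint S T)
    {f f' g g' : (ι → E) → ℝ} {B : ℝ} (hf : Measurable f) (hf' : Measurable f')
    (hg : Measurable g) (hg' : Measurable g') (hfB : ∀ u, |f u| ≤ B) (hf'B : ∀ u, |f' u| ≤ B)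
    (hgB : ∀ u, |g u| ≤ B) (hg'B : ∀ u, |g' u| ≤ B)
    (hS : DependsOn f' (S : Set ι)) (hT : DependsOn g' (T : Set ι)) :
    ENNReal.ofReal |cov[f, g; ρ]| ≤ ENNReal.ofReal (2 * B) *
      ((∫⁻ u, ENNReal.ofReal |f u - f' u| ∂ρ) + ∫⁻ u, ENNReal.ofReal |g u - g' u| ∂ρ) := by
  have hB : 0 ≤ B := (abs_nonneg _).trans (hfB (Classical.arbitrary _))
  have h_mem {h : (ι → E) → ℝ} (hh : Measurable h) (hhB : ∀ u, |h u| ≤ B) : MemLp h 2 ρ :=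
    MemLp.of_bound hh.aestronglyMeasurable B (ae_of_all _ hhB)
  have hf₂ := h_mem hf hfB
  have hf'₂ := h_mem hf' hf'B
  have hg₂ := h_mem hg hgB
  have hg'₂ := h_mem hg' hg'B
  have h_indep : cov[f', g'; ρ] = 0 :=
    (indepFun_of_dependsOn hρ hST hf' hg' hS hT).covariance_eq_zero hf'₂ hg'₂
  have h_split : cov[f, g; ρ] = cov[f - f', g; ρ] + cov[g - g', f'; ρ] := by
    rw [covariance_sub_left hf₂ hf'₂ hg₂, covariance_sub_left hg₂ hg'₂ hf'₂, covariance_comm g f',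
      covariance_comm g' f', h_indep]
    ring
  have h_lintegral {h h' : (ι → E) → ℝ} (hh : MemLp h 2 ρ) (hh' : MemLp h' 2 ρ) :
      ENNReal.ofReal (∫ u, |h u - h' u| ∂ρ) = ∫⁻ u, ENNReal.ofReal |h u - h' u| ∂ρ :=
    ofReal_integral_eq_lintegral_ofReal ((hh.sub hh').integrable one_le_two).abs
      (ae_of_all _ fun _ => abs_nonneg _)
  rw [← h_lintegral hf₂ hf'₂, ← h_lintegral hg₂ hg'₂, ← ENNReal.ofReal_add (by positivity)
    (by positivity), ← ENNReal.ofReal_mul (by positivity), h_split, mul_add]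
  exact ENNReal.ofReal_le_ofReal ((abs_add_le _ _).trans (add_le_add
    (abs_covariance_le (hf₂.sub hf'₂) hg₂ hgB) (abs_covariance_le (hg₂.sub hg'₂) hf'₂ hf'B)))

end Covariance

section Network

variable {n : ℕ} {G : SimpleGraph (Fin n)}

theorem mem_nbhd {i j : Fin n} {s : ℕ} : j ∈ nbhd G i s ↔ G.edist i j ≤ (s : ℕ∞) := by
  simp [nbhd]

theorem mem_sphere {i j : Fin n} {s : ℕ} : j ∈ sphere G i s ↔ G.edist i j = (s : ℕ∞) := by
  simp [sphere]

theorem self_mem_nbhd (i : Fin n) (s : ℕ) : i ∈ nbhd G i s := by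
  simp [mem_nbhd]

theorem disjoint_nbhd {i j : Fin n} {r : ℕ} (h : ((2 * r : ℕ) : ℕ∞) < G.edist i j) :
    Disjoint (nbhd G i r) (nbhd G j r) := by
  refine Finset.disjoint_left.2 fun k hi hj => h.not_ge ?_
  rw [mem_nbhd] at hi hj
  rw [SimpleGraph.edist_comm] at hj
  simpa [two_mul] using G.edist_triangle.trans (add_le_add hi hj)

theorem exists_mem_sphere {i j : Fin n} (hij : i ≠ j) (h : G.Reachable i j) :
    ∃ s ∈ Finset.Icc 1 n, j ∈ sphere G i s := by
  obtain ⟨p, hp, h_length⟩ := h.exists_path_of_dist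
  refine ⟨G.dist i j, Finset.mem_Icc.2 ⟨h.pos_dist_of_ne hij, ?_⟩,
    mem_sphere.2 h.coe_dist_eq_edist.symm⟩
  simpa [h_length] using hp.length_lt.le

theorem inv_mul_sum_sum_sphere (G : SimpleGraph (Fin n)) (w : ℕ → ℝ≥0∞) :
    (n : ℝ≥0∞)⁻¹ * ∑ i, ∑ j, ∑ s ∈ Finset.Icc 1 n, (if j ∈ sphere G i s then w s else 0) =
      ∑ s ∈ Finset.Icc 1 n, sphereAvg G s * w s := by
  simp only [Finset.sum_comm (s := Finset.univ) (t := Finset.Icc 1 n), Finset.sum_ite_mem,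
    Finset.univ_inter, Finset.sum_const, nsmul_eq_mul, Finset.mul_sum, sphereAvg, Finset.sum_mul,
    mul_assoc]

variable {E : Type*} [MeasurableSpace E]

/-- Uniformly bounded statistics `f r i` of the nodes of a network, of which `f r i` is a function
of the entries in the `r`-neighbourhood of `i`: approximations, indexed by the radius, of a
statistic of node `i`. -/
structure IsLocalFamily (G : SimpleGraph (Fin n)) (B : ℝ) (f : ℕ → Fin n → (Fin n → E) → ℝ) :
    Prop where
  measurable : ∀ r i, Measurable (f r i)
  abs_le : ∀ r i u, |f r i u| ≤ B
  dependsOn : ∀ r i, DependsOn (f r i) (nbhd G i r : Set (Fin n))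

namespace IsLocalFamily

variable {B : ℝ} {f : ℕ → Fin n → (Fin n → E) → ℝ} {ρ : Measure (Fin n → E)}
  [IsProbabilityMeasure ρ]

theorem memLp (hf : IsLocalFamily G B f) (r : ℕ) (i : Fin n) : MemLp (f r i) 2 ρ :=
  MemLp.of_bound (hf.measurable r i).aestronglyMeasurable B (ae_of_all _ (hf.abs_le r i))

theorem ofReal_variance_average_le_sum (hf : IsLocalFamily G B f) (r : ℕ) :
    ENNReal.ofReal (Var[fun u => (n : ℝ)⁻¹ * ∑ i, f r i u; ρ]) ≤
      (n : ℝ≥0∞)⁻¹ * ((n : ℝ≥0∞)⁻¹ * ∑ i, ∑ j, ENNReal.ofReal |cov[f r i, f r j; ρ]|) := by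
  rcases n.eq_zero_or_pos with rfl | hn
  · simp [← Pi.zero_def]
  · rw [variance_const_mul, variance_fun_sum fun i => hf.memLp r i, ← mul_assoc,
      ENNReal.ofReal_mul (sq_nonneg _), sq, ENNReal.ofReal_mul (by positivity),
      ENNReal.ofReal_inv_of_pos (by exact_mod_cast hn), ENNReal.ofReal_natCast]
    simp only [← ENNReal.ofReal_sum_of_nonneg fun _ _ => abs_nonneg _,
      ← ENNReal.ofReal_sum_of_nonneg fun _ _ => Finset.sum_nonneg fun _ _ => abs_nonneg _]
    gcongr with i _ j _
    exact le_abs_self _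

theorem ofReal_abs_covariance_self_le (hf : IsLocalFamily G B f) (r : ℕ) (i : Fin n) :
    ENNReal.ofReal |cov[f r i, f r i; ρ]| ≤ ENNReal.ofReal (2 * B * B) := by
  have h_mem : MemLp (f r i) 2 ρ := hf.memLp r i
  have hB : 0 ≤ B := by
    obtain ⟨u⟩ : Nonempty (Fin n → E) := nonempty_of_isProbabilityMeasure ρ
    exact (abs_nonneg _).trans (hf.abs_le r i u)
  refine ENNReal.ofReal_le_ofReal ((abs_covariance_le h_mem h_mem (hf.abs_le r i)).trans ?_)
  gcongr
  simpa using integral_mono (h_mem.integrable one_le_two).abs (integrable_const B) (hf.abs_le r i)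

variable [Nonempty E] {K : ℕ} {η : ℕ → ℝ≥0∞}

theorem ofReal_abs_covariance_le_sum (hf : IsLocalFamily G B f)
    (hρ : iIndepFun (fun (i : Fin n) (u : Fin n → E) => u i) ρ)
    (hη : ∀ r i, ∫⁻ u, ENNReal.ofReal |f K i u - f r i u| ∂ρ ≤ η r) {i j : Fin n} (hij : i ≠ j) :
    ENNReal.ofReal |cov[f K i, f K j; ρ]| ≤ ∑ s ∈ Finset.Icc 1 n,
      if j ∈ sphere G i s then ENNReal.ofReal (2 * B) * (2 * η ((s - 1) / 4)) else 0 := by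
  have h_cov (r : ℕ) (h : ((2 * r : ℕ) : ℕ∞) < G.edist i j) :=
    ofReal_abs_covariance_le hρ (disjoint_nbhd h) (hf.measurable K i) (hf.measurable r i)
      (hf.measurable K j) (hf.measurable r j) (hf.abs_le K i) (hf.abs_le r i) (hf.abs_le K j)
      (hf.abs_le r j) (hf.dependsOn r i) (hf.dependsOn r j)
  by_cases h_conn : G.Reachable i j
  · obtain ⟨s, hs, h_sphere⟩ := exists_mem_sphere hij h_conn
    have hs_pos : 1 ≤ s := (Finset.mem_Icc.1 hs).1
    have h_far : ((2 * ((s - 1) / 4) : ℕ) : ℕ∞) < G.edist i j := by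
      rw [mem_sphere.1 h_sphere]; exact_mod_cast (by omega : 2 * ((s - 1) / 4) < s)
    refine (h_cov _ h_far).trans ?_
    refine le_trans ?_ (Finset.single_le_sum (fun _ _ => zero_le) hs)
    rw [if_pos h_sphere, two_mul (η _)]
    gcongr <;> exact hη _ _
  · rw [← SimpleGraph.edist_ne_top_iff_reachable, not_not] at h_conn
    exact (h_cov K (h_conn ▸ ENat.natCast_lt_top _)).trans (by simp)

theorem ofReal_variance_average_le (hf : IsLocalFamily G B f)
    (hρ : iIndepFun (fun (i : Fin n) (u : Fin n → E) => u i) ρ)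
    (hη : ∀ r i, ∫⁻ u, ENNReal.ofReal |f K i u - f r i u| ∂ρ ≤ η r) :
    ENNReal.ofReal (Var[fun u => (n : ℝ)⁻¹ * ∑ i, f K i u; ρ]) ≤
      (n : ℝ≥0∞)⁻¹ * ENNReal.ofReal (2 * B * B) + ENNReal.ofReal (2 * B) * ((n : ℝ≥0∞)⁻¹ *
        ∑ s ∈ Finset.Icc 1 n, sphereAvg G s * (2 * η ((s - 1) / 4))) := by
  have h_pair (i j : Fin n) : ENNReal.ofReal |cov[f K i, f K j; ρ]| ≤
      (if i = j then ENNReal.ofReal (2 * B * B) else 0) + ∑ s ∈ Finset.Icc 1 n,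
        if j ∈ sphere G i s then ENNReal.ofReal (2 * B) * (2 * η ((s - 1) / 4)) else 0 := by
    rcases eq_or_ne i j with rfl | hij
    · rw [if_pos rfl]
      exact (hf.ofReal_abs_covariance_self_le K i).trans le_self_add
    · rw [if_neg hij, zero_add]
      exact hf.ofReal_abs_covariance_le_sum hρ hη hij
  have h_diag : (n : ℝ≥0∞)⁻¹ * ∑ i : Fin n, ∑ j, (if i = j then ENNReal.ofReal (2 * B * B) else 0) ≤
      ENNReal.ofReal (2 * B * B) := by
    simp only [Finset.sum_ite_eq, Finset.mem_univ, if_true, Finset.sum_const, Finset.card_univ,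
      Fintype.card_fin, nsmul_eq_mul, ← mul_assoc]
    exact mul_le_of_le_one_left' (ENNReal.inv_mul_le_one _)
  refine (hf.ofReal_variance_average_le_sum K).trans ?_
  grw [Finset.sum_le_sum fun i _ => Finset.sum_le_sum fun j _ => h_pair i j]
  simp only [Finset.sum_add_distrib, mul_add, inv_mul_sum_sum_sphere]
  grw [h_diag]
  simp only [Finset.mul_sum, mul_left_comm (ENNReal.ofReal (2 * B)), le_refl]

end IsLocalFamily

theorem lintegral_sq_norm_sub_integral {α ι : Type*} [MeasurableSpace α] [Fintype ι] {ρ : Measure α}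
    [IsProbabilityMeasure ρ] {F : α → EuclideanSpace ℝ ι} (hF : MemLp F 2 ρ) :
    ∫⁻ u, ENNReal.ofReal (‖F u - ∫ v, F v ∂ρ‖ ^ 2) ∂ρ =
      ∑ a, ENNReal.ofReal (Var[fun u => F u a; ρ]) := by
  have hF_coord (a : ι) : MemLp (fun u => F u a) 2 ρ := hF.eval_piLp a
  simp_rw [fun a => ofReal_variance (hF_coord a), evariance_eq_lintegral_ofReal]
  rw [← lintegral_finsetSum' _ fun a _ => by
    have := (hF_coord a).aestronglyMeasurable.aemeasurable
    fun_prop]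
  refine lintegral_congr fun u => ?_
  rw [EuclideanSpace.norm_sq_eq, ENNReal.ofReal_sum_of_nonneg fun a _ => sq_nonneg _]
  refine Finset.sum_congr rfl fun a _ => ?_
  rw [Real.norm_eq_abs, sq_abs, PiLp.sub_apply,
    eval_integral_piLp fun b => (hF_coord b).integrable one_le_two]

theorem lintegral_sq_norm_average_sub_integral_le [Nonempty E] {ι : Type*} [Fintype ι] {B : ℝ}
    {f : ℕ → Fin n → (Fin n → E) → EuclideanSpace ℝ ι}
    (hf : ∀ a, IsLocalFamily G B fun r i u => f r i u a)
    {ρ : Measure (Fin n → E)} [IsProbabilityMeasure ρ]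
    (hρ : iIndepFun (fun (i : Fin n) (u : Fin n → E) => u i) ρ) {K : ℕ} {η : ℕ → ℝ≥0∞}
    (hη : ∀ r i a, ∫⁻ u, ENNReal.ofReal |f K i u a - f r i u a| ∂ρ ≤ η r) :
    ∫⁻ u, ENNReal.ofReal (‖(n : ℝ)⁻¹ • ∑ i, f K i u - (n : ℝ)⁻¹ • ∑ i, ∫ v, f K i v ∂ρ‖ ^ 2) ∂ρ ≤
      Fintype.card ι * ((n : ℝ≥0∞)⁻¹ * ENNReal.ofReal (2 * B * B) + ENNReal.ofReal (2 * B) *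
        ((n : ℝ≥0∞)⁻¹ * ∑ s ∈ Finset.Icc 1 n, sphereAvg G s * (2 * η ((s - 1) / 4)))) := by
  have h_mem (i : Fin n) : MemLp (f K i) 2 ρ := MemLp.of_eval_piLp fun a => (hf a).memLp K i
  have h_integral : (n : ℝ)⁻¹ • ∑ i, ∫ v, f K i v ∂ρ = ∫ v, (n : ℝ)⁻¹ • ∑ i, f K i v ∂ρ := by
    rw [integral_smul, integral_finsetSum _ fun i _ => (h_mem i).integrable one_le_two]
  have h_coord (a : ι) : (fun u => ((n : ℝ)⁻¹ • ∑ i, f K i u) a) =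
      fun u => (n : ℝ)⁻¹ * ∑ i, f K i u a := by
    funext u
    simp
  have h_avg : MemLp (fun u => (n : ℝ)⁻¹ • ∑ i, f K i u) 2 ρ :=
    MemLp.of_eval_piLp fun a => h_coord a ▸
      (memLp_finsetSum Finset.univ fun i _ => (hf a).memLp K i).const_mul _
  rw [h_integral, lintegral_sq_norm_sub_integral h_avg, ← nsmul_eq_mul]
  refine Finset.sum_le_card_nsmul _ _ _ fun a _ => ?_
  rw [h_coord]
  exact (hf a).ofReal_variance_average_le hρ fun r i => hη r i a

end Network

/-! ### The equilibrium and its measurability -/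

theorem lipschitzWith_sigmoid : LipschitzWith (1 / 4) Real.sigmoid := by
  refine lipschitzWith_of_nnnorm_deriv_le differentiable_sigmoid fun x => ?_
  rw [← NNReal.coe_le_coe, coe_nnnorm, Real.deriv_sigmoid, Real.norm_eq_abs,
    abs_of_nonneg (mul_nonneg (Real.sigmoid_nonneg x) (sub_nonneg.2 (Real.sigmoid_le_one x)))]
  push_cast
  nlinarith [sq_nonneg (Real.sigmoid x - 1 / 2)]

section Equilibrium

variable {n kz : ℕ} (G : SimpleGraph (Fin n))

theorem adj_nonneg (i j : Fin n) : 0 ≤ adj G i j := by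
  unfold adj; split_ifs <;> norm_num

theorem rowAdj_nonneg (i j : Fin n) : 0 ≤ rowAdj G i j :=
  mul_nonneg (inv_nonneg.2 (Finset.sum_nonneg fun _ _ => adj_nonneg G _ _)) (adj_nonneg G _ _)

theorem sum_rowAdj_le_one (i : Fin n) : ∑ j, rowAdj G i j ≤ 1 := by
  simp only [rowAdj, ← Finset.mul_sum]
  exact inv_mul_le_one

theorem dist_choiceIndex_le (z : Fin n → Fin kz → ℝ) (b : Fin (kz + 1) → ℝ) (l : ℝ)
    (p p' : Fin n → ℝ) (i : Fin n) :
    dist (choiceIndex G z b l p i) (choiceIndex G z b l p' i) ≤ |l| * dist p p' := by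
  have h_sub : choiceIndex G z b l p i - choiceIndex G z b l p' i =
      l * ∑ j, rowAdj G i j * (p j - p' j) := by
    simp only [choiceIndex, mul_sub, Finset.sum_sub_distrib]
    ring
  rw [Real.dist_eq, h_sub, abs_mul]
  gcongr
  calc |∑ j, rowAdj G i j * (p j - p' j)|
      ≤ ∑ j, rowAdj G i j * dist p p' := by
        refine (Finset.abs_sum_le_sum_abs _ _).trans (Finset.sum_le_sum fun j _ => ?_)
        rw [abs_mul, abs_of_nonneg (rowAdj_nonneg G i j), ← Real.dist_eq]
        exact mul_le_mul_of_nonneg_left (dist_le_pi_dist p p' j) (rowAdj_nonneg G i j)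
    _ ≤ dist p p' := by
        rw [← Finset.sum_mul]
        exact mul_le_of_le_one_left dist_nonneg (sum_rowAdj_le_one G i)

/-- The map that sends beliefs about the choice probabilities to the choice probabilities of nodes
that respond optimally to them; its fixed points are the equilibria. -/
def bestResponse (z : Fin n → Fin kz → ℝ) (b : Fin (kz + 1) → ℝ) (l : ℝ) (p : Fin n → ℝ) :
    Fin n → ℝ :=
  fun i => Real.sigmoid (choiceIndex G z b l p i)

theorem contractingWith_bestResponse (z : Fin n → Fin kz → ℝ) (b : Fin (kz + 1) → ℝ) {l : ℝ}
    (hl : |l| < 4) : ContractingWith (1 / 4 * ‖l‖₊) (bestResponse G z b l) := by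
  refine ⟨?_, LipschitzWith.of_dist_le_mul fun p p' => ?_⟩
  · rw [← NNReal.coe_lt_coe]
    push_cast
    rw [Real.norm_eq_abs]
    linarith
  · refine (dist_pi_le_iff (by positivity)).2 fun i =>
      (lipschitzWith_sigmoid.dist_le_mul _ _).trans ?_
    rw [NNReal.coe_mul, mul_assoc, coe_nnnorm]
    gcongr
    exact dist_choiceIndex_le G z b l p p' i

theorem isEquilibrium_iff_isFixedPt {z : Fin n → Fin kz → ℝ} {b : Fin (kz + 1) → ℝ} {l : ℝ}
    {p : Fin n → ℝ} : IsEquilibrium G z b l p ↔ Function.IsFixedPt (bestResponse G z b l) p :=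
  ⟨fun h => funext fun i => (h i).symm, fun h i => (congrFun h i).symm⟩

theorem isFixedPt_eqProb (z : Fin n → Fin kz → ℝ) (b : Fin (kz + 1) → ℝ) {l : ℝ}
    (hl : |l| < 4) : Function.IsFixedPt (bestResponse G z b l) (eqProb G z b l) := by
  have h_exists : ∃ p, IsEquilibrium G z b l p := ⟨_, (isEquilibrium_iff_isFixedPt G).2
    (contractingWith_bestResponse G z b hl).fixedPoint_isFixedPt⟩
  rw [eqProb, dif_pos h_exists]
  exact (isEquilibrium_iff_isFixedPt G).1 h_exists.choose_spec

theorem tendsto_iterate_bestResponse (z : Fin n → Fin kz → ℝ) (b : Fin (kz + 1) → ℝ) {l : ℝ}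
    (hl : |l| < 4) :
    Tendsto (fun k => (bestResponse G z b l)^[k] 0) atTop (𝓝 (eqProb G z b l)) := by
  have h_contr := contractingWith_bestResponse G z b hl
  rw [h_contr.fixedPoint_unique (isFixedPt_eqProb G z b hl)]
  exact h_contr.tendsto_iterate_fixedPoint 0

variable {α : Type*} [MeasurableSpace α] {z : α → Fin n → Fin kz → ℝ}

@[fun_prop]
theorem measurable_withIntercept (hz : Measurable z) (i : Fin n) (k : Fin (kz + 1)) :
    Measurable fun a => withIntercept (z a i) k := by
  cases k using Fin.cases with
  | zero => simp only [withIntercept, Fin.cons_zero, measurable_const]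
  | succ k => simp only [withIntercept, Fin.cons_succ]; fun_prop

theorem measurable_choiceIndex (hz : Measurable z) (b : Fin (kz + 1) → ℝ) (l : ℝ)
    {p : α → Fin n → ℝ} (hp : Measurable p) (i : Fin n) :
    Measurable fun a => choiceIndex G (z a) b l (p a) i := by
  unfold choiceIndex; fun_prop

theorem measurable_eqProb (hz : Measurable z) (b : Fin (kz + 1) → ℝ) {l : ℝ} (hl : |l| < 4) :
    Measurable fun a => eqProb G (z a) b l := by
  refine measurable_of_tendsto_metrizable (f := fun k a => (bestResponse G (z a) b l)^[k] 0)
    (fun k => ?_) (tendsto_pi_nhds.2 fun a => tendsto_iterate_bestResponse G (z a) b hl)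
  induction k with
  | zero => exact measurable_const
  | succ k ih =>
    simp only [Function.iterate_succ', Function.comp_apply]
    exact measurable_pi_lambda _ fun i =>
      continuous_sigmoid.measurable.comp (measurable_choiceIndex G hz b l ih i)

theorem measurable_matrix_inv_apply {ι : Type*} [Fintype ι] [DecidableEq ι]
    {A : α → Matrix ι ι ℝ} (hA : ∀ i j, Measurable fun a => A a i j) (i j : ι) :
    Measurable fun a => (A a)⁻¹ i j := by
  have hA' : Measurable fun (a : α) (i : ι) (j : ι) => A a i j :=
    measurable_pi_lambda _ fun i => measurable_pi_lambda _ fun j => hA i j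
  have h_det : Continuous fun B : ι → ι → ℝ => Matrix.det (Matrix.of B) :=
    Continuous.matrix_det continuous_id
  have h_adjugate : Continuous fun B : ι → ι → ℝ => Matrix.adjugate (Matrix.of B) i j :=
    (Continuous.matrix_adjugate (A := fun B : ι → ι → ℝ => Matrix.of B)
      continuous_id).matrix_elem i j
  simp only [Matrix.inv_def, Matrix.smul_apply, Ring.inverse_eq_inv', smul_eq_mul]
  exact ((h_det.measurable.comp hA').inv).mul (h_adjugate.measurable.comp hA')

theorem measurable_scoreMatrix_inv (hz : Measurable z) (b : Fin (kz + 1) → ℝ) {l : ℝ}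
    (hl : |l| < 4) (i j : Fin n) : Measurable fun a => (scoreMatrix G (z a) b l)⁻¹ i j := by
  refine measurable_matrix_inv_apply (fun i j => ?_) i j
  have hP := measurable_eqProb G hz b hl
  simp only [scoreMatrix, Matrix.sub_apply, Matrix.diagonal_apply]
  split_ifs <;> fun_prop

theorem measurable_dProbBD (hz : Measurable z) (b : Fin (kz + 1) → ℝ) {l : ℝ} (hl : |l| < 4)
    (k : Fin (kz + 1)) (j : Fin n) : Measurable fun a => dProbBD G (z a) b l k j := by
  simp only [dProbBD, Matrix.mulVec, dotProduct]
  exact Finset.measurable_sum _ fun i _ =>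
    (measurable_scoreMatrix_inv G hz b hl j i).mul (measurable_withIntercept hz i k)

theorem measurable_dProbLam (hz : Measurable z) (b : Fin (kz + 1) → ℝ) {l : ℝ} (hl : |l| < 4)
    (j : Fin n) : Measurable fun a => dProbLam G (z a) b l j := by
  have hP : ∀ i, Measurable fun a => eqProb G (z a) b l i := fun i =>
    (measurable_pi_apply i).comp (measurable_eqProb G hz b hl)
  simp only [dProbLam, Matrix.mulVec, dotProduct]
  exact Finset.measurable_sum _ fun i _ => (measurable_scoreMatrix_inv G hz b hl j i).mul
    (Finset.measurable_sum _ fun k _ => (hP k).const_mul _)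

end Equilibrium

section Moment

variable {n kz kx q : ℕ}

instance : MeasurableSingletonClass (SimpleGraph (Fin n)) where
  measurableSet_singleton G := by
    have h_preimage : ({G} : Set (SimpleGraph (Fin n))) = SimpleGraph.Adj ⁻¹' {G.Adj} := by
      ext H
      simp [SimpleGraph.adj_inj]
    exact h_preimage ▸ SimpleGraph.measurable_adj (measurableSet_singleton _)

theorem measurable_treat (b : Fin (kz + 1) → ℝ) {l : ℝ} (hl : |l| < 4) :
    Measurable fun a : SimpleGraph (Fin n) × (Fin n → Fin kz → ℝ) × (Fin n → ℝ) =>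
      treat a.1 a.2.1 b l a.2.2 := by
  refine measurable_from_prod_countable_right fun G => measurable_pi_lambda _ fun i => ?_
  have h_index : Measurable fun a : (Fin n → Fin kz → ℝ) × (Fin n → ℝ) =>
      choiceIndex G a.1 b l (eqProb G a.1 b l) i - a.2 i :=
    (measurable_choiceIndex G measurable_fst b l (measurable_eqProb G measurable_fst b hl) i).sub
      (by fun_prop)
  refine measurable_to_bool ?_
  simp only [treat, Set.preimage, Set.mem_singleton_iff, decide_eq_true_eq]
  exact h_index measurableSet_Ici

theorem measurable_control (t : Expo q) : Measurable (control t) := by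
  unfold control; split_ifs <;> fun_prop

theorem measurable_secondStage {α : Type*} [MeasurableSpace α] (t : Expo q) {p : α → ℝ}
    {w : α → WPoint q} {x : α → Fin kx → ℝ} (hp : Measurable p) (hw : Measurable w)
    (hx : Measurable x) (b : Fin kx ⊕ Unit → ℝ) (c : Fin kx ⊕ Unit) :
    Measurable fun a => secondStage t (p a) (w a) (x a) b c := by
  classical
  have h_control : Measurable fun a => control t (p a) := (measurable_control t).comp hp
  have h_level : Measurable fun a => if (w a).2.1 = t then (1 : ℝ) else 0 :=
    Measurable.ite (hw.snd.fst (measurableSet_singleton t)) measurable_const measurable_const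
  cases c <;> simp only [secondStage, Sum.elim_inl, Sum.elim_inr] <;> fun_prop

theorem measurable_moment (t t' : Expo q) (i : Fin n) (β : Param kz kx) (hβ : |paramLam β| < 4) :
    Measurable fun a : SimpleGraph (Fin n) × WPoint q × (Fin kx → ℝ) × (Fin n → Fin kz → ℝ) =>
      moment t t' a.1 i a.2.1 a.2.2.1 a.2.2.2 β := by
  refine measurable_from_prod_countable_right fun G =>
    (MeasurableEquiv.toLp 2 _).measurable.comp (measurable_pi_lambda _ fun c => ?_)
  have hz : Measurable fun a : WPoint q × (Fin kx → ℝ) × (Fin n → Fin kz → ℝ) => a.2.2 := by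
    fun_prop
  have hP := measurable_eqProb G hz (paramD β) hβ
  have h_dBD := measurable_dProbBD G hz (paramD β) hβ
  have h_dLam := measurable_dProbLam G hz (paramD β) hβ
  rcases c with (k | _) | (c | c) <;> simp only [Sum.elim_inl, Sum.elim_inr]
  · fun_prop
  · fun_prop
  · exact measurable_secondStage t (by fun_prop) measurable_fst measurable_snd.fst _ c
  · exact measurable_secondStage t' (by fun_prop) measurable_fst measurable_snd.fst _ c

end Moment

/-! ### The array as a function of the shocks -/

theorem truncTreat_self {n : ℕ} (G : SimpleGraph (Fin n)) (i : Fin n) (s : ℕ) (d : Fin n → Bool) :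
    truncTreat G i s d i = d i := by
  simp [truncTreat, self_mem_nbhd]

namespace NetworkModel

variable {Ω : Type*} {kz kx q : ℕ} (M : NetworkModel Ω kz kx q)

/-- The data point `(y, t, d)` of node `i` under the treatment vector `d`. -/
def WPot (n : ℕ) (i : Fin n) (d : Fin n → Bool) (ω : Ω) : WPoint q :=
  (M.YPot n i d ω, M.TPot n i d ω, bval (d i))

/-- The data point of node `i` with the treatments outside `N(i,s)` set to zero. -/
def WTrunc (n : ℕ) (i : Fin n) (s : ℕ) (ω : Ω) : WPoint q :=
  M.WPot n i (truncTreat (M.A n ω) i s (M.D n ω)) ω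

/-- The exposure levels that occur in rows with `n` nodes. -/
def levels (n : ℕ) : Set (Expo q) :=
  Set.range fun a : SimpleGraph (Fin n) × Fin n × (Fin n → Bool) => M.expo n a.1 a.2.1 a.2.2

instance (n : ℕ) : Finite (M.levels n) := inferInstanceAs (Finite (Set.range _))

/-- The exposure of a node as an element of the set of levels. -/
def level (n : ℕ) (G : SimpleGraph (Fin n)) (i : Fin n) (d : Fin n → Bool) : M.levels n :=
  ⟨M.expo n G i d, (G, i, d), rfl⟩

/-- The private shock of a node with its outcome errors. Only the errors at the finitely many
levels that occur are recorded, since `Expo q → ℝ` is not a standard Borel space. -/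
abbrev NodeShock (n : ℕ) : Type := ℝ × (M.levels n → ℝ)

/-- The sample space with the `σ`-algebra `C_n`: conditioning on `C_n` is conditioning on the
identity map into it. -/
def CommonShocks (_M : NetworkModel Ω kz kx q) (_n : ℕ) : Type _ := Ω

instance (n : ℕ) : MeasurableSpace (M.CommonShocks n) := M.C n

/-- All that is random in row `n`: the common shocks and the shocks of the nodes. -/
abbrev Shocks (n : ℕ) : Type _ := M.CommonShocks n × (Fin n → M.NodeShock n)

/-- The realisation of the common shocks. -/
def commonShocks (n : ℕ) (ω : Ω) : M.CommonShocks n := ω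

/-- The realisation of the shocks of the nodes. -/
def nodeShocks (n : ℕ) (ω : Ω) : Fin n → M.NodeShock n :=
  fun i => (M.ν n i ω, fun a => M.e n i ω a)

/-- The realisation of all shocks of row `n`. -/
def shocks (n : ℕ) (ω : Ω) : M.Shocks n := (M.commonShocks n ω, M.nodeShocks n ω)

/-- The treatments `𝐃_n` as a function of the shocks. -/
def DAt (n : ℕ) (p : M.Shocks n) : Fin n → Bool :=
  treat (M.A n p.1) (M.Zmat n p.1) M.bD M.lam fun j => (p.2 j).1

/-- The data point of node `i` with covariates `x` and shock `u` under the treatments `d`. -/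
def dataPoint (n : ℕ) (i : Fin n) (G : SimpleGraph (Fin n)) (d : Fin n → Bool) (x : Fin kx → ℝ)
    (u : M.NodeShock n) : WPoint q :=
  ((∑ k, x k * M.bX (M.expo n G i d) k) + Real.sigmoid u.1 * M.bp (M.expo n G i d)
    + u.2 (M.level n G i d), M.expo n G i d, bval (d i))

/-- `W_{n,i}` as a function of the shocks. -/
def WAt (n : ℕ) (i : Fin n) (p : M.Shocks n) : WPoint q :=
  M.dataPoint n i (M.A n p.1) (M.DAt n p) (M.X n i p.1) (p.2 i)

/-- `W_{n,i}` with the treatments outside `N(i,s)` set to zero, as a function of the shocks. -/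
def WTruncAt (n : ℕ) (i : Fin n) (s : ℕ) (p : M.Shocks n) : WPoint q :=
  M.dataPoint n i (M.A n p.1) (truncTreat (M.A n p.1) i s (M.DAt n p)) (M.X n i p.1) (p.2 i)

/-- The arguments `(A_n, (W_{n,i}, X_{n,i}, 𝐙))` of the moment function of node `i` as a function
of the shocks. -/
def dataAt (n : ℕ) (i : Fin n) (p : M.Shocks n) :
    SimpleGraph (Fin n) × WPoint q × (Fin kx → ℝ) × (Fin n → Fin kz → ℝ) :=
  (M.A n p.1, M.WAt n i p, M.X n i p.1, M.Zmat n p.1)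

/-- The moments of node `i` as a function of the shocks. -/
def gAt (t t' : Expo q) (n : ℕ) (i : Fin n) (β : Param kz kx) (p : M.Shocks n) : Param kz kx :=
  moment t t' (M.A n p.1) i (M.WAt n i p) (M.X n i p.1) (M.Zmat n p.1) β

/-- The exposure of a node is determined by the treatments in its component of the network. -/
def IsComponentLocal : Prop :=
  ∀ n G i d d', (∀ j, SimpleGraph.Reachable G i j → d j = d' j) → M.expo n G i d = M.expo n G i d'

variable {M}

theorem ExposureAssumption.isComponentLocal {K : ℕ} (h : M.ExposureAssumption K) :
    M.IsComponentLocal := fun n G i d d' hd =>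
  h.isLocal n G i d d' fun j hj => hd j (SimpleGraph.edist_ne_top_iff_reachable.1
    (ne_top_of_le_ne_top (ENat.natCast_ne_top K) (mem_nbhd.1 hj)))

theorem dependsOn_WTruncAt {n : ℕ} (i : Fin n) (s : ℕ) (c : M.CommonShocks n) :
    DependsOn (fun u => M.WTruncAt n i s (c, u)) (nbhd (M.A n c) i s : Set (Fin n)) := by
  intro u v huv
  have h_self : u i = v i := huv i (self_mem_nbhd i s)
  have h_treat : truncTreat (M.A n c) i s (M.DAt n (c, u)) =
      truncTreat (M.A n c) i s (M.DAt n (c, v)) := by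
    funext j
    simp only [truncTreat]
    split_ifs with hj
    · simp only [DAt, treat, huv j hj]
    · rfl
  simp only [WTruncAt, h_self, h_treat]

/-- A node at finite distance from `i` in a network with `n` nodes has distance at most `n`. -/
theorem WTruncAt_eq_WAt (hexpo : M.IsComponentLocal) {n : ℕ} (i : Fin n) (p : M.Shocks n) :
    M.WTruncAt n i n p = M.WAt n i p := by
  have h_expo : M.expo n (M.A n p.1) i (truncTreat (M.A n p.1) i n (M.DAt n p)) =
      M.expo n (M.A n p.1) i (M.DAt n p) := by
    refine hexpo _ _ _ _ _ fun j hj => if_pos (mem_nbhd.2 ?_)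
    obtain ⟨w, hw, h_length⟩ := hj.exists_path_of_dist
    rw [← hj.coe_dist_eq_edist, ← h_length]
    exact_mod_cast (hw.length_lt.trans_eq (Fintype.card_fin n)).le
  have h_level : M.level n (M.A n p.1) i (truncTreat (M.A n p.1) i n (M.DAt n p)) =
      M.level n (M.A n p.1) i (M.DAt n p) := Subtype.ext h_expo
  simp only [WTruncAt, WAt, dataPoint, h_expo, h_level, truncTreat_self]

theorem comap_commonShocks (n : ℕ) :
    MeasurableSpace.comap (M.commonShocks n) (inferInstance : MeasurableSpace (M.CommonShocks n)) =
      M.C n :=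
  MeasurableSpace.comap_id

theorem measurable_dataPoint (n : ℕ) (i : Fin n) :
    Measurable fun a : (SimpleGraph (Fin n) × (Fin n → Bool)) × (Fin kx → ℝ) × M.NodeShock n =>
      M.dataPoint n i a.1.1 a.1.2 a.2.1 a.2.2 := by
  refine measurable_from_prod_countable_right fun a => ?_
  have h_sigmoid : Measurable Real.sigmoid := continuous_sigmoid.measurable
  have h_x : Measurable fun b : (Fin kx → ℝ) × M.NodeShock n =>
      ∑ k, b.1 k * M.bX (M.expo n a.1 i a.2) k :=
    Finset.measurable_sum _ fun k _ => Measurable.mul_const (by fun_prop) _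
  have h_e : Measurable fun b : (Fin kx → ℝ) × M.NodeShock n => b.2.2 (M.level n a.1 i a.2) := by
    fun_prop
  exact ((h_x.add ((h_sigmoid.comp measurable_snd.fst).mul_const
    (M.bp (M.expo n a.1 i a.2)))).add h_e).prodMk
      (measurable_const (a := (M.expo n a.1 i a.2, bval (a.2 i))))

section Measurability

variable [MeasurableSpace Ω]

theorem measurable_commonShocks (hM : M.IsMeasurable) (n : ℕ) : Measurable (M.commonShocks n) :=
  fun s hs => hM.le n s hs

theorem measurable_nodeShocks (hM : M.IsMeasurable) (n : ℕ) : Measurable (M.nodeShocks n) :=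
  measurable_pi_lambda _ fun i => (hM.shocks n i).prodMk
    (measurable_pi_lambda _ fun _ => (measurable_pi_apply _).comp (hM.errors n i))

theorem measurable_shocks (hM : M.IsMeasurable) (n : ℕ) : Measurable (M.shocks n) :=
  (measurable_commonShocks hM n).prodMk (measurable_nodeShocks hM n)

theorem measurable_network (hM : M.IsMeasurable) (n : ℕ) :
    Measurable fun p : M.Shocks n => M.A n p.1 := by
  have h_net : Measurable fun c : M.CommonShocks n => M.A n c :=
    SimpleGraph.measurable_iff_adj.2 fun i j => measurableSet_setOfPred.1 (hM.network n i j)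
  exact h_net.comp measurable_fst

theorem measurable_covariates (hM : M.IsMeasurable) (n : ℕ) (i : Fin n) :
    Measurable fun p : M.Shocks n => M.X n i p.1 :=
  Measurable.comp (g := fun c : M.CommonShocks n => M.X n i c) (hM.covariates n i) measurable_fst

theorem measurable_exogenous (hM : M.IsMeasurable) (n : ℕ) :
    Measurable fun p : M.Shocks n => M.Zmat n p.1 :=
  measurable_pi_lambda _ fun i =>
    Measurable.comp (g := fun c : M.CommonShocks n => M.Z n i c) (hM.exogenous n i) measurable_fst

theorem measurable_DAt (hM : M.IsMeasurable) (hlam : |M.lam| < 4) (n : ℕ) :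
    Measurable (M.DAt n) := by
  have h_args : Measurable fun p : M.Shocks n => (M.A n p.1, M.Zmat n p.1, fun j => (p.2 j).1) :=
    (measurable_network hM n).prodMk ((measurable_exogenous hM n).prodMk (measurable_pi_lambda _
      fun j => ((measurable_pi_apply j).comp measurable_snd).fst))
  have h_treat := (measurable_treat M.bD hlam).comp h_args
  unfold DAt
  exact h_treat

theorem measurable_WAt (hM : M.IsMeasurable) (hlam : |M.lam| < 4) (n : ℕ) (i : Fin n) :
    Measurable (M.WAt n i) :=
  (measurable_dataPoint n i).comp (((measurable_network hM n).prodMk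
    (measurable_DAt hM hlam n)).prodMk ((measurable_covariates hM n i).prodMk (by fun_prop)))

theorem measurable_WTruncAt (hM : M.IsMeasurable) (hlam : |M.lam| < 4) (n : ℕ) (i : Fin n)
    (s : ℕ) : Measurable (M.WTruncAt n i s) := by
  have h_trunc : Measurable fun a : SimpleGraph (Fin n) × (Fin n → Bool) =>
      truncTreat a.1 i s a.2 := .of_discrete
  exact (measurable_dataPoint n i).comp (((measurable_network hM n).prodMk
    (h_trunc.comp ((measurable_network hM n).prodMk (measurable_DAt hM hlam n)))).prodMk
      ((measurable_covariates hM n i).prodMk (by fun_prop)))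

theorem measurable_dataAt (hM : M.IsMeasurable) (hlam : |M.lam| < 4) (n : ℕ) (i : Fin n) :
    Measurable (M.dataAt n i) :=
  (measurable_network hM n).prodMk ((measurable_WAt hM hlam n i).prodMk
    ((measurable_covariates hM n i).prodMk (measurable_exogenous hM n)))

theorem measurable_gAt (hM : M.IsMeasurable) (hlam : |M.lam| < 4) (t t' : Expo q) (n : ℕ)
    (i : Fin n) {β : Param kz kx} (hβ : |paramLam β| < 4) : Measurable (M.gAt t t' n i β) :=
  (measurable_moment t t' i β hβ).comp (measurable_dataAt hM hlam n i)

variable {μ : Measure Ω}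

theorem measurableSet_dataAt_mem (hM : M.IsMeasurable) (hlam : |M.lam| < 4) (n : ℕ) (i : Fin n) :
    MeasurableSet {p | (M.dataAt n i p).2 ∈ M.dataSupport μ n i (M.dataAt n i p).1} := by
  have h_closed : ∀ G, MeasurableSet (M.dataSupport μ n i G) := fun G =>
    Measure.isClosed_support.measurableSet
  have h_support : Measurable fun a : SimpleGraph (Fin n) × WPoint q × (Fin kx → ℝ) ×
      (Fin n → Fin kz → ℝ) => a.2 ∈ M.dataSupport μ n i a.1 :=
    measurable_from_prod_countable_right fun G => (h_closed G).mem
  exact measurableSet_setOfPred.2 (h_support.comp (measurable_dataAt hM hlam n i))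

theorem ae_dataAt_mem (hM : M.IsMeasurable) (hlam : |M.lam| < 4) (n : ℕ) (i : Fin n) :
    ∀ᵐ ω ∂μ, (M.dataAt n i (M.shocks n ω)).2 ∈ M.dataSupport μ n i (M.A n ω) := by
  have h_data : Measurable fun ω => M.dataAt n i (M.shocks n ω) :=
    (measurable_dataAt hM hlam n i).comp (measurable_shocks hM n)
  have h_fibre : ∀ G : SimpleGraph (Fin n), ∀ᵐ ω ∂μ, M.A n ω = G →
      (M.dataAt n i (M.shocks n ω)).2 ∈ M.dataSupport μ n i G := fun G =>
    (ae_restrict_iff' (h_data.fst (measurableSet_singleton G))).1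
      (ae_of_ae_map h_data.snd.aemeasurable Measure.support_mem_ae)
  filter_upwards [ae_all_iff.2 h_fibre] with ω hω using hω _ rfl

theorem condIndepFamily_nodeShocks {n : ℕ}
    (h : CondIndepFamily (M.C n) μ fun i ω => (M.ν n i ω, M.e n i ω)) :
    CondIndepFamily (M.C n) μ fun i ω => M.nodeShocks n ω i := by
  have h_restrict : Measurable fun a : ℝ × (Expo q → ℝ) =>
      ((a.1, fun τ => a.2 τ) : M.NodeShock n) := by fun_prop
  exact fun B hB => h _ fun i => h_restrict (hB i)

end Measurability

end NetworkModel

/-! ### The conditional law of large numbers -/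

theorem wDist_le_two_mul_dist {q : ℕ} (w w' : WPoint q) : wDist w w' ≤ 2 * dist w w' := by
  have h_y : |w.1 - w'.1| ≤ dist w w' := le_max_left _ _
  have h_t : ‖w.2.1 - w'.2.1‖ ≤ dist w w' := by
    rw [← dist_eq_norm]; exact (le_max_left _ _).trans (le_max_right (dist w.1 w'.1) _)
  have h_d : |w.2.2 - w'.2.2| ≤ dist w w' := (le_max_right _ _).trans (le_max_right _ _)
  refine Real.sqrt_le_iff.2 ⟨by positivity, ?_⟩
  nlinarith [pow_le_pow_left₀ (abs_nonneg _) h_y 2, pow_le_pow_left₀ (norm_nonneg _) h_t 2,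
    pow_le_pow_left₀ (abs_nonneg _) h_d 2, sq_nonneg (dist w w')]

theorem exists_bounded_lipschitzWith_extension {α ι : Type*} [PseudoMetricSpace α] [Fintype ι]
    {S : Set α} {f : α → EuclideanSpace ℝ ι} {B C : NNReal} (hB : ∀ w ∈ S, ‖f w‖ ≤ B)
    (hf : LipschitzOnWith C f S) :
    ∃ h : α → EuclideanSpace ℝ ι, (∀ a, LipschitzWith C fun w => h w a) ∧
      (∀ w a, |h w a| ≤ B) ∧ Set.EqOn f h S := by
  have h_extend (a : ι) : ∃ h : α → ℝ, LipschitzWith C h ∧ Set.EqOn (fun w => f w a) h S := by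
    refine LipschitzOnWith.extend_real (LipschitzOnWith.of_dist_le_mul fun w hw w' hw' => ?_)
    refine le_trans ?_ (hf.dist_le_mul w hw w' hw')
    rw [dist_eq_norm, dist_eq_norm, ← PiLp.sub_apply]
    exact PiLp.norm_apply_le (f w - f w') a
  choose h h_lip h_eq using h_extend
  refine ⟨fun w => WithLp.toLp 2 fun a => max (-(B : ℝ)) (min B (h a w)),
    fun a => ((h_lip a).const_min B).const_max (-B), fun w a => ?_, fun w hw => ?_⟩
  · exact abs_le.2 ⟨le_max_left _ _, max_le (neg_le_self B.2) (min_le_left _ _)⟩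
  · ext a
    have h_le : |f w a| ≤ B := (PiLp.norm_apply_le (f w) a).trans (hB w hw)
    have h_coord : f w a = h a w := h_eq a hw
    change f w a = max (-(B : ℝ)) (min B (h a w))
    rw [← h_coord, min_eq_right (abs_le.1 h_le).2, max_eq_right (abs_le.1 h_le).1]

theorem lintegral_le_rpow_lintegral_sq {α : Type*} [MeasurableSpace α] {ρ : Measure α}
    [IsProbabilityMeasure ρ] {f : α → ℝ≥0∞} (hf : Measurable f) :
    ∫⁻ u, f u ∂ρ ≤ (∫⁻ u, f u ^ 2 ∂ρ) ^ (1 / 2 : ℝ) := by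
  simpa [eLpNorm'] using
    eLpNorm'_le_eLpNorm'_of_exponent_le one_pos one_le_two ρ hf.aestronglyMeasurable

namespace NetworkModel

variable {Ω : Type*} {kz kx q : ℕ} {M : NetworkModel Ω kz kx q}

theorem edist_W_WTrunc_le (n : ℕ) (i : Fin n) (s : ℕ) (ω : Ω) :
    edist (M.W n i ω) (M.WTrunc n i s ω) ≤ ENNReal.ofReal |M.Y n i ω - M.YTrunc n i s ω| +
      ENNReal.ofReal ‖M.T n i ω - M.TTrunc n i s ω‖ := by
  have h_treat : (M.W n i ω).2.2 = (M.WTrunc n i s ω).2.2 := by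
    simp only [W, WTrunc, WPot, truncTreat_self]
  rw [Prod.edist_eq, Prod.edist_eq, h_treat, edist_self, max_eq_left zero_le, edist_dist,
    edist_dist, Real.dist_eq, dist_eq_norm]
  exact max_le le_self_add le_add_self

variable [MeasurableSpace Ω] {μ : Measure Ω}

variable (M μ) in
/-- On the support of the data, the moment function at `β` is bounded by `B` and `L`-Lipschitz in
the data point of the node. -/
def IsBoundedLipschitz (t t' : Expo q) (B L : ℝ) (β : Param kz kx) : Prop :=
  ∀ n i G x z w, (w, x, z) ∈ M.dataSupport μ n i G → ‖moment t t' G i w x z β‖ ≤ B ∧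
    ∀ w', (w', x, z) ∈ M.dataSupport μ n i G →
      ‖moment t t' G i w x z β - moment t t' G i w' x z β‖ ≤ L * wDist w w'

variable (M μ) in
/-- `max_i E[dist(W_i, W_i^{(s)}) | C_n]`: the error of approximating the data point of a node by
the one determined by the treatments in its `s`-neighbourhood. -/
def truncError (n s : ℕ) (ω : Ω) : ℝ≥0∞ :=
  ⨆ i, condLExp (M.C n) μ (fun ω' => edist (M.W n i ω') (M.WTrunc n i s ω')) ω

variable {t t' : Expo q} {β : Param kz kx} {B L : NNReal}

theorem IsBoundedLipschitz.lipschitzOnWith (hg : M.IsBoundedLipschitz μ t t' B L β) {n : ℕ}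
    (i : Fin n) (G : SimpleGraph (Fin n)) (x : Fin kx → ℝ) (z : Fin n → Fin kz → ℝ) :
    LipschitzOnWith (2 * L) (fun w => moment t t' G i w x z β)
      {w | (w, x, z) ∈ M.dataSupport μ n i G} := by
  refine LipschitzOnWith.of_dist_le_mul fun w hw w' hw' => ?_
  rw [dist_eq_norm]
  calc ‖moment t t' G i w x z β - moment t t' G i w' x z β‖
      ≤ L * wDist w w' := (hg n i G x z w hw).2 w' hw'
    _ ≤ L * (2 * dist w w') := by gcongr; exact wDist_le_two_mul_dist w w'
    _ = ↑(2 * L) * dist w w' := by push_cast; ring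

/-- The local approximations are extensions of the moment function off the support of the data,
evaluated at the truncated data points, which may lie outside the support. -/
theorem exists_isLocalFamily (hM : M.IsMeasurable) (hlam : |M.lam| < 4)
    (hg : M.IsBoundedLipschitz μ t t' B L β) {n : ℕ}
    (hexpo : M.IsComponentLocal) (c : M.CommonShocks n) :
    ∃ f : ℕ → Fin n → (Fin n → M.NodeShock n) → Param kz kx,
      (∀ a, IsLocalFamily (M.A n c) B fun r i u => f r i u a) ∧
      (∀ r i u a, ENNReal.ofReal |f n i u a - f r i u a| ≤
        2 * L * edist (M.WAt n i (c, u)) (M.WTruncAt n i r (c, u))) ∧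
      ∀ i u, (M.dataAt n i (c, u)).2 ∈ M.dataSupport μ n i (M.A n c) →
        f n i u = M.gAt t t' n i β (c, u) := by
  choose h h_lip h_le h_eq using fun i => exists_bounded_lipschitzWith_extension
    (S := {w | (w, M.X n i c, M.Zmat n c) ∈ M.dataSupport μ n i (M.A n c)})
    (fun w hw => (hg n i _ _ _ w hw).1) (hg.lipschitzOnWith i _ _ _)
  refine ⟨fun r i u => h i (M.WTruncAt n i r (c, u)), fun a => ⟨fun r i => ?_, fun r i u => ?_,
    fun r i u v huv => ?_⟩, fun r i u a => ?_, fun i u hu => ?_⟩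
  · exact (h_lip i a).continuous.measurable.comp
      ((measurable_WTruncAt hM hlam n i r).comp measurable_prodMk_left)
  · exact h_le i _ a
  · exact congrArg (fun w => h i w a) (dependsOn_WTruncAt i r c huv)
  · beta_reduce
    rw [WTruncAt_eq_WAt hexpo, ← Real.dist_eq, ← edist_dist]
    exact_mod_cast h_lip i a _ _
  · beta_reduce
    rw [WTruncAt_eq_WAt hexpo]
    exact (h_eq i hu).symm

variable [IsProbabilityMeasure μ]

variable (M μ) in
/-- The regular conditional distribution of the shocks of the nodes given the common shocks. -/
def shockKernel (n : ℕ) : Kernel (M.CommonShocks n) (Fin n → M.NodeShock n) :=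
  condDistrib (M.nodeShocks n) (M.commonShocks n) μ

instance (n : ℕ) : IsMarkovKernel (M.shockKernel μ n) :=
  inferInstanceAs (IsMarkovKernel (condDistrib _ _ _))

variable (M) in
/-- The sample moments `ĝ_n(β)` as a function of the shocks. -/
def gHatAt (t t' : Expo q) (n : ℕ) (β : Param kz kx) (p : M.Shocks n) : Param kz kx :=
  (n : ℝ)⁻¹ • ∑ i, M.gAt t t' n i β p

variable (M μ) in
/-- The population moments `g_n(β)` as a function of the common shocks. -/
def gPopAt (t t' : Expo q) (n : ℕ) (β : Param kz kx) (c : M.CommonShocks n) : Param kz kx :=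
  (n : ℝ)⁻¹ • ∑ i, ∫ u, M.gAt t t' n i β (c, u) ∂M.shockKernel μ n c

variable (M μ) in
/-- `truncError` as a function of the common shocks. -/
def truncErrorAt (n s : ℕ) (c : M.CommonShocks n) : ℝ≥0∞ :=
  ⨆ i, ∫⁻ u, edist (M.WAt n i (c, u)) (M.WTruncAt n i s (c, u)) ∂M.shockKernel μ n c

theorem measurable_gHatAt (hM : M.IsMeasurable) (hlam : |M.lam| < 4) (t t' : Expo q)
    (hβ : |paramLam β| < 4) (n : ℕ) : Measurable (M.gHatAt t t' n β) := by
  have h_sum : Measurable fun p => ∑ i, M.gAt t t' n i β p :=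
    Finset.measurable_sum _ fun i _ => measurable_gAt hM hlam t t' n i hβ
  exact h_sum.const_smul (n : ℝ)⁻¹

theorem measurable_gPopAt (hM : M.IsMeasurable) (hlam : |M.lam| < 4) (t t' : Expo q)
    (hβ : |paramLam β| < 4) (n : ℕ) : Measurable (M.gPopAt μ t t' n β) := by
  have h_sum : Measurable fun c => ∑ i, ∫ u, M.gAt t t' n i β (c, u) ∂M.shockKernel μ n c :=
    Finset.measurable_sum _ fun i _ =>
      (measurable_gAt hM hlam t t' n i hβ).stronglyMeasurable.integral_condDistrib.measurable
  exact h_sum.const_smul (n : ℝ)⁻¹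

theorem condLExp_shocks_ae_eq (hM : M.IsMeasurable) {n : ℕ} {F : M.Shocks n → ℝ≥0∞}
    (hF : Measurable F) :
    condLExp (M.C n) μ (fun ω => F (M.shocks n ω)) =ᵐ[μ]
      fun ω => ∫⁻ u, F (M.commonShocks n ω, u) ∂M.shockKernel μ n (M.commonShocks n ω) :=
  comap_commonShocks (M := M) n ▸ condLExp_ae_eq_lintegral_condDistrib
    (measurable_commonShocks hM n) (measurable_nodeShocks hM n) hF

theorem integrable_g (hM : M.IsMeasurable) (hlam : |M.lam| < 4) (hβ : |paramLam β| < 4)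
    (hg : M.IsBoundedLipschitz μ t t' B L β) {n : ℕ} (i : Fin n) :
    Integrable (M.g t t' n i β) μ := by
  refine Integrable.of_bound ((measurable_gAt hM hlam t t' n i hβ).comp
    (measurable_shocks hM n)).aestronglyMeasurable B ?_
  filter_upwards [ae_dataAt_mem hM hlam n i] with ω hω using (hg n i _ _ _ _ hω).1

theorem gPop_ae_eq (hM : M.IsMeasurable) (hlam : |M.lam| < 4) (hβ : |paramLam β| < 4)
    (hg : M.IsBoundedLipschitz μ t t' B L β) (n : ℕ) :
    M.gPop μ t t' n β =ᵐ[μ] fun ω => M.gPopAt μ t t' n β (M.commonShocks n ω) := by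
  have h_node (i : Fin n) : μ[M.g t t' n i β | M.C n] =ᵐ[μ] fun ω =>
      ∫ u, M.gAt t t' n i β (M.commonShocks n ω, u) ∂M.shockKernel μ n (M.commonShocks n ω) :=
    comap_commonShocks (M := M) n ▸ condExp_prod_ae_eq_integral_condDistrib
      (measurable_commonShocks hM n) (measurable_nodeShocks hM n).aemeasurable
      (measurable_gAt hM hlam t t' n i hβ).stronglyMeasurable (integrable_g hM hlam hβ hg i)
  filter_upwards [ae_all_iff.2 h_node] with ω hω
  simp only [gPop, gPopAt, hω]

theorem ae_ae_dataAt_mem (hM : M.IsMeasurable) (hlam : |M.lam| < 4) (n : ℕ) (i : Fin n) :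
    ∀ᵐ ω ∂μ, ∀ᵐ u ∂M.shockKernel μ n (M.commonShocks n ω),
      (M.dataAt n i (M.commonShocks n ω, u)).2 ∈ M.dataSupport μ n i (M.A n ω) :=
  ae_ae_condDistrib (measurable_commonShocks hM n) (measurable_nodeShocks hM n)
    (measurableSet_dataAt_mem hM hlam n i) (ae_dataAt_mem hM hlam n i)

theorem truncError_ae_eq (hM : M.IsMeasurable) (hlam : |M.lam| < 4) (n s : ℕ) :
    M.truncError μ n s =ᵐ[μ] fun ω => M.truncErrorAt μ n s (M.commonShocks n ω) := by
  have h_edist (i : Fin n) :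
      Measurable fun p : M.Shocks n => edist (M.WAt n i p) (M.WTruncAt n i s p) :=
    (measurable_WAt hM hlam n i).edist (measurable_WTruncAt hM hlam n i s)
  have h_node (i : Fin n) :
      condLExp (M.C n) μ (fun ω => edist (M.W n i ω) (M.WTrunc n i s ω)) =ᵐ[μ] fun ω =>
        ∫⁻ u, edist (M.WAt n i (M.commonShocks n ω, u)) (M.WTruncAt n i s (M.commonShocks n ω, u))
          ∂M.shockKernel μ n (M.commonShocks n ω) :=
    condLExp_shocks_ae_eq hM (h_edist i)
  filter_upwards [ae_all_iff.2 h_node] with ω hω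
  exact iSup_congr hω

theorem lintegral_sq_norm_gHatAt_sub_gPopAt_le (hM : M.IsMeasurable) (hlam : |M.lam| < 4)
    (hg : M.IsBoundedLipschitz μ t t' B L β) {n : ℕ}
    (hexpo : M.IsComponentLocal) {c : M.CommonShocks n}
    (h_indep : iIndepFun (fun (i : Fin n) (u : Fin n → M.NodeShock n) => u i)
      (M.shockKernel μ n c))
    (h_support : ∀ i, ∀ᵐ u ∂M.shockKernel μ n c,
      (M.dataAt n i (c, u)).2 ∈ M.dataSupport μ n i (M.A n c)) :
    ∫⁻ u, ENNReal.ofReal (‖M.gHatAt t t' n β (c, u) - M.gPopAt μ t t' n β c‖ ^ 2)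
        ∂M.shockKernel μ n c ≤
      Fintype.card (PIdx kz kx) * ((n : ℝ≥0∞)⁻¹ * ENNReal.ofReal (2 * B * B) +
        ENNReal.ofReal (2 * B) * ((n : ℝ≥0∞)⁻¹ * ∑ s ∈ Finset.Icc 1 n, sphereAvg (M.A n c) s *
          (2 * (2 * L * M.truncErrorAt μ n ((s - 1) / 4) c)))) := by
  obtain ⟨f, h_local, h_approx, h_eq⟩ := exists_isLocalFamily hM hlam hg hexpo c
  have h_ae : ∀ᵐ u ∂M.shockKernel μ n c, ∀ i, M.gAt t t' n i β (c, u) = f n i u := by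
    filter_upwards [ae_all_iff.2 h_support] with u hu i using (h_eq i u (hu i)).symm
  have h_pop : M.gPopAt μ t t' n β c =
      (n : ℝ)⁻¹ • ∑ i, ∫ u, f n i u ∂M.shockKernel μ n c := by
    refine congrArg _ (Finset.sum_congr rfl fun i _ => integral_congr_ae ?_)
    filter_upwards [h_ae] with u hu using hu i
  have h_hat : ∀ᵐ u ∂M.shockKernel μ n c,
      M.gHatAt t t' n β (c, u) = (n : ℝ)⁻¹ • ∑ i, f n i u := by
    filter_upwards [h_ae] with u hu using congrArg _ (Finset.sum_congr rfl fun i _ => hu i)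
  have h_lintegral : ∫⁻ u, ENNReal.ofReal (‖M.gHatAt t t' n β (c, u) - M.gPopAt μ t t' n β c‖ ^ 2)
      ∂M.shockKernel μ n c = ∫⁻ u, ENNReal.ofReal (‖((n : ℝ)⁻¹ • ∑ i, f n i u) -
        (n : ℝ)⁻¹ • ∑ i, ∫ u, f n i u ∂M.shockKernel μ n c‖ ^ 2) ∂M.shockKernel μ n c := by
    refine lintegral_congr_ae ?_
    filter_upwards [h_hat] with u hu
    rw [hu, h_pop]
  rw [h_lintegral]
  refine lintegral_sq_norm_average_sub_integral_le (η := fun r => 2 * L * M.truncErrorAt μ n r c)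
    h_local h_indep fun r i a => ?_
  calc ∫⁻ u, ENNReal.ofReal |f n i u a - f r i u a| ∂M.shockKernel μ n c
      ≤ ∫⁻ u, 2 * L * edist (M.WAt n i (c, u)) (M.WTruncAt n i r (c, u))
          ∂M.shockKernel μ n c := lintegral_mono fun u => h_approx r i u a
    _ = 2 * L * ∫⁻ u, edist (M.WAt n i (c, u)) (M.WTruncAt n i r (c, u))
          ∂M.shockKernel μ n c :=
        lintegral_const_mul' _ _ (ENNReal.mul_ne_top ENNReal.ofNat_ne_top ENNReal.coe_ne_top)
    _ ≤ 2 * L * M.truncErrorAt μ n r c := mul_le_mul_right (le_iSup (fun i => ∫⁻ u,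
          edist (M.WAt n i (c, u)) (M.WTruncAt n i r (c, u)) ∂M.shockKernel μ n c) i) _

theorem condLExp_norm_gHat_sub_gPop_le (hM : M.IsMeasurable) (hlam : |M.lam| < 4) {n : ℕ}
    (h_indep : CondIndepFamily (M.C n) μ fun i ω => (M.ν n i ω, M.e n i ω))
    (hexpo : M.IsComponentLocal)
    (hβ : |paramLam β| < 4) (hg : M.IsBoundedLipschitz μ t t' B L β) :
    ∀ᵐ ω ∂μ, condLExp (M.C n) μ
        (fun ω' => ENNReal.ofReal ‖M.gHat t t' n β ω' - M.gPop μ t t' n β ω'‖) ω ≤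
      (Fintype.card (PIdx kz kx) * ((n : ℝ≥0∞)⁻¹ * ENNReal.ofReal (2 * B * B) +
        ENNReal.ofReal (2 * B) * (2 * (2 * L) * ((n : ℝ≥0∞)⁻¹ * ∑ s ∈ Finset.Icc 1 n,
          sphereAvg (M.A n ω) s * M.truncError μ n ((s - 1) / 4) ω)))) ^ (1 / 2 : ℝ) := by
  set F : M.Shocks n → ℝ := fun p => ‖M.gHatAt t t' n β p - M.gPopAt μ t t' n β p.1‖
  have hF : Measurable F := ((measurable_gHatAt hM hlam t t' hβ n).sub
    ((measurable_gPopAt hM hlam t t' hβ n).comp measurable_fst)).norm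
  have h_kernel : condLExp (M.C n) μ
      (fun ω' => ENNReal.ofReal ‖M.gHat t t' n β ω' - M.gPop μ t t' n β ω'‖) =ᵐ[μ] fun ω =>
      ∫⁻ u, ENNReal.ofReal (F (M.commonShocks n ω, u))
        ∂M.shockKernel μ n (M.commonShocks n ω) := by
    refine (condLExp_congr_ae ?_).trans (condLExp_shocks_ae_eq hM hF.ennreal_ofReal)
    filter_upwards [gPop_ae_eq hM hlam hβ hg n] with ω hω
    rw [hω]
    rfl
  have h_iIndep := iIndepFun_condDistrib (measurable_commonShocks hM n) (measurable_nodeShocks hM n)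
    (comap_commonShocks (M := M) n ▸ condIndepFamily_nodeShocks h_indep)
  filter_upwards [h_kernel, h_iIndep, ae_all_iff.2 fun i => ae_ae_dataAt_mem (μ := μ) hM hlam n i,
    ae_all_iff.2 fun s => truncError_ae_eq (μ := μ) hM hlam n s]
    with ω h_kernel h_iIndep h_support h_trunc
  rw [h_kernel]
  refine (lintegral_le_rpow_lintegral_sq (f := fun u => ENNReal.ofReal (F (M.commonShocks n ω, u)))
    (hF.ennreal_ofReal.comp measurable_prodMk_left)).trans ?_
  simp only [← ENNReal.ofReal_pow (norm_nonneg _), F, h_trunc]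
  refine ENNReal.rpow_le_rpow ((lintegral_sq_norm_gHatAt_sub_gPopAt_le hM hlam hg hexpo h_iIndep
    h_support).trans_eq ?_) (by norm_num)
  have h_network : M.A n (M.commonShocks n ω) = M.A n ω := rfl
  simp only [h_network, Finset.mul_sum]
  congr! 4 with s
  ring

theorem tendstoInCondMean_norm_gHat_sub_gPop (hM : M.IsMeasurable) (hlam : |M.lam| < 4)
    (h_indep : ∀ n, CondIndepFamily (M.C n) μ fun i ω => (M.ν n i ω, M.e n i ω))
    (hexpo : M.IsComponentLocal)
    (hdecay : ∀ᵐ ω ∂μ, Tendsto (fun n : ℕ => (n : ℝ≥0∞)⁻¹ * ∑ s ∈ Finset.Icc 1 n,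
      sphereAvg (M.A n ω) s * M.truncError μ n ((s - 1) / 4) ω) atTop (𝓝 0))
    (hβ : |paramLam β| < 4) (hg : M.IsBoundedLipschitz μ t t' B L β) :
    TendstoInCondMean μ M.C fun n ω =>
      ENNReal.ofReal ‖M.gHat t t' n β ω - M.gPop μ t t' n β ω‖ := by
  filter_upwards [hdecay, ae_all_iff.2 fun n => condLExp_norm_gHat_sub_gPop_le (n := n) hM hlam
    (h_indep n) hexpo hβ hg] with ω h_decay h_le
  refine tendsto_of_tendsto_of_tendsto_of_le_of_le tendsto_const_nhds ?_ (fun _ => zero_le) h_le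
  have h_sqrt : Tendsto (fun x : ℝ≥0∞ => x ^ (1 / 2 : ℝ)) (𝓝 0) (𝓝 0) :=
    ENNReal.continuous_rpow_const.tendsto' 0 0 (by simp)
  refine h_sqrt.comp ?_
  have h_inv : Tendsto (fun n : ℕ => (n : ℝ≥0∞)⁻¹ * ENNReal.ofReal (2 * B * B)) atTop (𝓝 0) := by
    simpa using ENNReal.Tendsto.mul_const ENNReal.tendsto_inv_nat_nhds_zero
      (Or.inr (ENNReal.ofReal_ne_top (r := 2 * B * B)))
  have h_L : (2 * (2 * L) : ℝ≥0∞) ≠ ⊤ := by finiteness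
  have h_sum := ENNReal.Tendsto.const_mul (a := ENNReal.ofReal (2 * B))
    (ENNReal.Tendsto.const_mul h_decay (.inr h_L)) (.inr ENNReal.ofReal_ne_top)
  have h_total := ENNReal.Tendsto.const_mul (h_inv.add h_sum)
    (.inr (ENNReal.natCast_ne_top (Fintype.card (PIdx kz kx))))
  simpa only [mul_zero, add_zero] using h_total

end NetworkModel

/-! ### Regularity of the moments and consistency -/

theorem norm_average_le {E : Type*} [SeminormedAddCommGroup E] [NormedSpace ℝ E] {n : ℕ}
    {v : Fin n → E} {b : ℝ} (hb : 0 ≤ b) (hv : ∀ i, ‖v i‖ ≤ b) : ‖(n : ℝ)⁻¹ • ∑ i, v i‖ ≤ b := by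
  have h_sum : ‖∑ i, v i‖ ≤ n * b := by
    simpa using norm_sum_le_of_le Finset.univ fun i _ => hv i
  rw [norm_smul, norm_inv, Real.norm_natCast]
  exact inv_mul_le_of_le_mul₀ n.cast_nonneg hb h_sum

namespace NetworkModel

variable {Ω : Type*} {kz kx q : ℕ} {M : NetworkModel Ω kz kx q} [MeasurableSpace Ω]
  {μ : Measure Ω} {t t' : Expo q} {Θ : Set (Param kz kx)} {B L : NNReal}

variable (M μ) in
/-- On the support of the data, the moment function is `L`-Lipschitz in the parameter on `Θ`. -/
def IsLipschitzInParam (t t' : Expo q) (Θ : Set (Param kz kx)) (L : ℝ) : Prop :=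
  ∀ n i G x z w, (w, x, z) ∈ M.dataSupport μ n i G → ∀ β ∈ Θ, ∀ β' ∈ Θ,
    ‖moment t t' G i w x z β - moment t t' G i w x z β'‖ ≤ L * ‖β - β'‖

theorem IsLipschitzInParam.toNNReal {L : ℝ} (hL : M.IsLipschitzInParam μ t t' Θ L) :
    M.IsLipschitzInParam μ t t' Θ L.toNNReal := fun n i G x z w hw β hβ β' hβ' =>
  (hL n i G x z w hw β hβ β' hβ').trans (by gcongr; exact L.le_coe_toNNReal)

theorem IsLipschitzInParam.exists_isBoundedLipschitz (hL : M.IsLipschitzInParam μ t t' Θ L)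
    (hΘ : Bornology.IsBounded Θ) (hg : ∀ β ∈ Θ, ∃ B L : ℝ, M.IsBoundedLipschitz μ t t' B L β) :
    ∃ B : NNReal, ∀ β ∈ Θ, ∃ L : NNReal, M.IsBoundedLipschitz μ t t' B L β := by
  obtain rfl | ⟨β₀, hβ₀⟩ := Θ.eq_empty_or_nonempty
  · exact ⟨0, by simp⟩
  obtain ⟨B₀, L₀, hg₀⟩ := hg β₀ hβ₀
  obtain ⟨R, hR⟩ := Metric.isBounded_iff.1 hΘ
  refine ⟨(L * R + B₀).toNNReal, fun β hβ => ?_⟩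
  obtain ⟨B', L', hg'⟩ := hg β hβ
  refine ⟨L'.toNNReal, fun n i G x z w hw => ⟨?_, fun w' hw' => ?_⟩⟩
  · calc ‖moment t t' G i w x z β‖
        ≤ ‖moment t t' G i w x z β - moment t t' G i w x z β₀‖ + ‖moment t t' G i w x z β₀‖ :=
          norm_le_norm_sub_add _ _
      _ ≤ L * ‖β - β₀‖ + B₀ := add_le_add (hL n i G x z w hw β hβ β₀ hβ₀) (hg₀ n i G x z w hw).1
      _ ≤ L * R + B₀ := by gcongr; exact dist_eq_norm β β₀ ▸ hR hβ hβ₀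
      _ ≤ (L * R + B₀).toNNReal := Real.le_coe_toNNReal _
  · exact ((hg' n i G x z w hw).2 w' hw').trans
      (mul_le_mul_of_nonneg_right L'.le_coe_toNNReal (Real.sqrt_nonneg _))

theorem ae_lipschitzOnWith_gHat (hM : M.IsMeasurable) (hlam : |M.lam| < 4)
    (hL : M.IsLipschitzInParam μ t t' Θ L) (n : ℕ) :
    ∀ᵐ ω ∂μ, LipschitzOnWith L (fun β => M.gHat t t' n β ω) Θ := by
  filter_upwards [ae_all_iff.2 fun i => ae_dataAt_mem (μ := μ) hM hlam n i] with ω hω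
  refine LipschitzOnWith.of_dist_le_mul fun β hβ β' hβ' => ?_
  rw [dist_eq_norm, dist_eq_norm, gHat, gHat, ← smul_sub, ← Finset.sum_sub_distrib]
  exact norm_average_le (by positivity) fun i => hL n i _ _ _ _ (hω i) β hβ β' hβ'

theorem measurable_gHat (hM : M.IsMeasurable) (hlam : |M.lam| < 4) (t t' : Expo q) (n : ℕ)
    {β : Param kz kx} (hβ : |paramLam β| < 4) : Measurable (M.gHat t t' n β) := by
  have h_comp : Measurable fun ω => M.gHatAt t t' n β (M.shocks n ω) :=
    Measurable.comp (g := M.gHatAt t t' n β) (f := M.shocks n)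
      (measurable_gHatAt hM hlam t t' hβ n) (measurable_shocks hM n)
  exact h_comp

theorem measurable_gPop (t t' : Expo q) (n : ℕ) (β : Param kz kx) :
    Measurable[M.C n] (M.gPop μ t t' n β) := by
  have h_sum : Measurable[M.C n] fun ω => ∑ i, (μ[M.g t t' n i β | M.C n]) ω :=
    Finset.measurable_sum _ fun i _ => stronglyMeasurable_condExp.measurable
  exact h_sum.const_smul (n : ℝ)⁻¹

theorem ae_truncError_le_thetaW (hM : M.IsMeasurable) (hlam : |M.lam| < 4) (n s : ℕ) :
    ∀ᵐ ω ∂μ, M.truncError μ n s ω ≤ M.thetaW μ n s ω := by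
  have h_outcome (i : Fin n) :
      Measurable fun ω => ENNReal.ofReal |M.Y n i ω - M.YTrunc n i s ω| :=
    (((measurable_WAt hM hlam n i).fst.sub (measurable_WTruncAt hM hlam n i s).fst).norm.comp
      (measurable_shocks hM n)).ennreal_ofReal
  have h_node (i : Fin n) := (condLExp_mono (mΩ := M.C n) (ae_of_all μ
    (edist_W_WTrunc_le (M := M) n i s))).trans_eq (condLExp_add_left _ (h_outcome i).aemeasurable)
  filter_upwards [ae_all_iff.2 h_node] with ω hω
  refine (iSup_le fun i => (hω i).trans (add_le_add ?_ ?_)).trans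
    ((le_mul_of_one_le_left zero_le one_le_two).trans le_self_add)
  · exact le_iSup (fun i => condLExp (M.C n) μ
      (fun ω' => ENNReal.ofReal |M.Y n i ω' - M.YTrunc n i s ω'|) ω) i
  · exact le_iSup (fun i => condLExp (M.C n) μ
      (fun ω' => ENNReal.ofReal ‖M.T n i ω' - M.TTrunc n i s ω'‖) ω) i

theorem RegularityLLN.decay_truncError (hreg : M.RegularityLLN μ t t' Θ) (hM : M.IsMeasurable)
    (hlam : |M.lam| < 4) :
    ∀ᵐ ω ∂μ, Tendsto (fun n : ℕ => (n : ℝ≥0∞)⁻¹ * ∑ s ∈ Finset.Icc 1 n,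
      sphereAvg (M.A n ω) s * M.truncError μ n ((s - 1) / 4) ω) atTop (𝓝 0) := by
  filter_upwards [hreg.decay, ae_all_iff.2 fun n => ae_all_iff.2 fun s =>
    ae_truncError_le_thetaW (μ := μ) hM hlam n s] with ω h_decay h_le
  refine tendsto_of_tendsto_of_tendsto_of_le_of_le tendsto_const_nhds h_decay (fun _ => zero_le)
    fun n => ?_
  dsimp only
  gcongr
  exact h_le _ _

theorem WeightAssumption.convergentWeights
    {Xihat Xi : ℕ → Ω → Matrix (PIdx kz kx) (PIdx kz kx) ℝ} (h : M.WeightAssumption μ Xihat Xi) :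
    ConvergentWeights μ M.C Xihat Xi :=
  ⟨h.measurable_hat, h.measurable_pop, h.bounded, h.tendsto⟩

variable [IsProbabilityMeasure μ]

theorem ae_norm_gPop_le (hM : M.IsMeasurable) (hlam : |M.lam| < 4) {β : Param kz kx}
    (hβ : |paramLam β| < 4) (hg : M.IsBoundedLipschitz μ t t' B L β) (n : ℕ) :
    ∀ᵐ ω ∂μ, ‖M.gPop μ t t' n β ω‖ ≤ B := by
  filter_upwards [gPop_ae_eq hM hlam hβ hg n,
    ae_all_iff.2 fun i => ae_ae_dataAt_mem (μ := μ) hM hlam n i] with ω h_eq h_support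
  rw [h_eq, gPopAt]
  refine norm_average_le B.2 fun i => ?_
  have h_bound := norm_integral_le_of_norm_le_const
    (f := fun u => M.gAt t t' n i β (M.commonShocks n ω, u)) (C := B)
    ((h_support i).mono fun u hu => (hg n i _ _ _ _ hu).1)
  simpa using h_bound

theorem regularMoments (hM : M.IsMeasurable) (hlam : |M.lam| < 4)
    (h_indep : ∀ n, CondIndepFamily (M.C n) μ fun i ω => (M.ν n i ω, M.e n i ω))
    (hexpo : M.IsComponentLocal)
    (hdecay : ∀ᵐ ω ∂μ, Tendsto (fun n : ℕ => (n : ℝ≥0∞)⁻¹ * ∑ s ∈ Finset.Icc 1 n,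
      sphereAvg (M.A n ω) s * M.truncError μ n ((s - 1) / 4) ω) atTop (𝓝 0))
    (hpeer : ∀ β ∈ Θ, |paramLam β| < 4)
    (hg : ∀ β ∈ Θ, ∃ L : NNReal, M.IsBoundedLipschitz μ t t' B L β)
    (hL : M.IsLipschitzInParam μ t t' Θ L) :
    RegularMoments μ M.C Θ (M.gHat t t') (M.gPop μ t t') B L where
  le := hM.le
  measurable_hat n β hβ := measurable_gHat hM hlam t t' n (hpeer β hβ)
  measurable_pop n β _ := measurable_gPop t t' n β
  norm_hat_le n := by
    filter_upwards [ae_all_iff.2 fun i => ae_dataAt_mem (μ := μ) hM hlam n i] with ω hω β hβ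
    obtain ⟨L', hg'⟩ := hg β hβ
    exact norm_average_le B.2 fun i => (hg' n i _ _ _ _ (hω i)).1
  norm_pop_le n β hβ := (hg β hβ).elim fun _ hg' => ae_norm_gPop_le hM hlam (hpeer β hβ) hg' n
  lipschitz := ae_lipschitzOnWith_gHat hM hlam hL
  lln β hβ := (hg β hβ).elim fun _ hg' =>
    tendstoInCondMean_norm_gHat_sub_gPop hM hlam h_indep hexpo hdecay (hpeer β hβ) hg'

end NetworkModel

end NetworkGMM

end

open NetworkGMM in
theorem mainTheorem5_general {Ω : Type*} [MeasurableSpace Ω] (μ : Measure Ω)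
    [IsProbabilityMeasure μ] {kz kx q : ℕ} (M : NetworkModel Ω kz kx q) (t t' : Expo q)
    (Θ : Set (Param kz kx)) (β₀ : Param kz kx)
    (Xihat Xi : ℕ → Ω → Matrix (PIdx kz kx) (PIdx kz kx) ℝ)
    (βhat : ℕ → Ω → Param kz kx)
    (hmeas : M.IsMeasurable)
    (hindep : ∀ n, CondIndepFamily (M.C n) μ fun i ω => (M.ν n i ω, M.e n i ω))
    (hexpo : M.IsComponentLocal)
    (hlam : |M.lam| < 4)
    (hdecay : ∀ᵐ ω ∂μ, Tendsto (fun n : ℕ => (n : ℝ≥0∞)⁻¹ * ∑ s ∈ Finset.Icc 1 n,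
      sphereAvg (M.A n ω) s * M.truncError μ n ((s - 1) / 4) ω) atTop (𝓝 0))
    (hcompact : IsCompact Θ)
    (hpeer : ∀ β ∈ Θ, |paramLam β| < 4)
    (hbdd : ∀ β ∈ Θ, ∃ B L : ℝ, M.IsBoundedLipschitz μ t t' B L β)
    (hequi : ∃ L : ℝ, M.IsLipschitzInParam μ t t' Θ L)
    (hweight : ConvergentWeights μ M.C Xihat Xi)
    (hident : M.IsIdentified μ t t' Θ Xi β₀)
    (hβ_meas : ∀ n, Measurable (βhat n))
    (hβ_min : ∀ n, 1 ≤ n → ∀ᵐ ω ∂μ, βhat n ω ∈ Θ ∧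
      ∀ β ∈ Θ, M.QHat t t' Xihat n (βhat n ω) ω ≤ M.QHat t t' Xihat n β ω) :
    (∀ ε : ℝ, 0 < ε → ∀ᵐ ω ∂μ, Tendsto
      (fun n => (μ⟦{ω' | ε < ‖βhat n ω' - β₀‖} | M.C n⟧) ω) atTop (𝓝 0)) ∧
    TendstoInMeasure μ βhat atTop (fun _ => β₀) := by
  obtain ⟨L, hL⟩ := hequi
  obtain ⟨B, hB⟩ := hL.toNNReal.exists_isBoundedLipschitz hcompact.isBounded hbdd
  have hg := NetworkModel.regularMoments hmeas hlam hindep hexpo hdecay hpeer hB hL.toNNReal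
  have hβ : IsMinimumDistance μ Θ (M.gHat t t') Xihat βhat :=
    ⟨hβ_meas, (eventually_ge_atTop 1).mono hβ_min⟩
  have h_zero : ∀ᶠ n in atTop, ∀ᵐ ω ∂μ, M.gPop μ t t' n β₀ ω = 0 :=
    (eventually_ge_atTop 1).mono hident.moment_eq_zero
  have h_far (ε : ℝ) (hε : 0 < ε) :
      TendstoInCondMean μ M.C fun n => {ω | ε < dist (βhat n ω) β₀}.indicator 1 := by
    obtain ⟨κ, hκ, h_sep⟩ := hident.separated ε hε
    simp only [← dist_eq_norm] at h_sep
    exact hβ.tendstoInCondMean hcompact hg hweight hident.mem h_zero hκ h_sep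
  refine ⟨fun ε hε => ?_, tendstoInMeasure_of_tendstoInCondMean hmeas.le hβ_meas h_far⟩
  simp only [← dist_eq_norm]
  exact (h_far ε hε).tendsto_condExp fun n =>
    measurableSet_lt measurable_const ((hβ_meas n).dist measurable_const)

open NetworkGMM in
theorem mainTheorem5 {Ω : Type*} [MeasurableSpace Ω] (μ : Measure Ω) [IsProbabilityMeasure μ]
    {kz kx q : ℕ} (M : NetworkModel Ω kz kx q) (t t' : Expo q) (K : ℕ)
    (Θ : Set (Param kz kx))
    (Xihat Xi : ℕ → Ω → Matrix (PIdx kz kx) (PIdx kz kx) ℝ)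
    (βhat : ℕ → Ω → Param kz kx)
    (hmeas : M.IsMeasurable)
    (hshock : M.ShockAssumption μ)
    (hexpo : M.ExposureAssumption K)
    (hreg : M.RegularityLLN μ t t' Θ)
    (hweight : M.WeightAssumption μ Xihat Xi)
    (hident : M.IsIdentified μ t t' Θ Xi (M.trueParam t t'))
    (hβ_meas : ∀ n, Measurable (βhat n))
    (hβ_min : ∀ n, 1 ≤ n → ∀ᵐ ω ∂μ, βhat n ω ∈ Θ ∧
      ∀ β ∈ Θ, M.QHat t t' Xihat n (βhat n ω) ω ≤ M.QHat t t' Xihat n β ω) :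
    (∀ ε : ℝ, 0 < ε → ∀ᵐ ω ∂μ, Tendsto
      (fun n => (μ⟦{ω' | ε < ‖βhat n ω' - M.trueParam t t'‖} | M.C n⟧) ω) atTop (𝓝 0)) ∧
    TendstoInMeasure μ βhat atTop (fun _ => M.trueParam t t') := by
  have hlam := hreg.peer _ hident.mem
  exact mainTheorem5_general μ M t t' Θ _ Xihat Xi βhat hmeas hshock.indep hexpo.isComponentLocal
    hlam (hreg.decay_truncError hmeas hlam) hreg.compact hreg.peer hreg.boundedLipschitz
    (hreg.equicontinuous.imp fun _ h => h.2) hweight.convergentWeights hident hβ_meas hβ_min
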